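/- Let $(W,S)$ be a Coxeter system with $S$ finite, $\ell$ its length function, $\Gamma$ a totally ordered abelian group, and $\varphi : W \to \Gamma$ a weight function, i.e. $\varphi(ww')=\varphi(w)+\varphi(w')$ whenever $\ell(ww')=\ell(w)+\ell(w')$. Put $A=\mathbb{Z}[\Gamma]=\bigoplus_{\gamma\in\Gamma}\mathbb{Z}e^\gamma$. Let $\mathcal{H}$ be the Hecke algebra of $(W,S,\Gamma,\varphi)$: the $A$-algebra generated by elements $T_w$ ($w\in W$) with $T_1=1$, $T_wT_{w'}=T_{ww'}$ if $\ell(ww')=\ell(w)+\ell(w')$, and $(T_s-e^{\varphi(s)})(T_s+e^{-\varphi(s)})=0$ for $s\in S$. Its bar involution is the ring involution with $\overline{e^\gamma}=e^{-\gamma}$ and $\overline{T_w}=T_{w^{-1}}^{-1}$, and the Kazhdan-Lusztig element $C_w$ is the unique element with $\overline{C_w}=C_w$ and $C_w-T_w\in\bigoplus_{x\in W}A_{<0}T_x$, where $A_{<0}=\bigoplus_{\gamma<0}\mathbb{Z}e^\gamma$. Let $p$ be a prime number and let $G$ be a non-trivial finite $p$-group of automorphisms $\sigma$ of $W$ such that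 $\sigma(S)=S$ and $\varphi\circ\sigma=\varphi$; it acts on $\mathcal{H}$ by automorphisms of $A$-algebra via $\sigma(T_w)=T_{\sigma(w)}$. Let $W^G$ be the group of fixed points, let $S_G$ be the set of the longest elements $s_\omega$ of $W_\omega=\langle\omega\rangle$, where $\omega$ runs over the $G$-orbits in $S$ such that $W_\omega$ is finite, and let $\varphi_G$ be the restriction of $\varphi$ to $W^G$. Denote by $\mathcal{H}_G$, $T_w^G$, $C_w^G$ ($w\in W^G$) the Hecke algebra, the standard elements and the Kazhdan-Lusztig elements attached in the same way to $(W^G,S_G,\Gamma,\varphi_G)$. Let $\mathrm{Br}_G(\mathcal{H})=\mathcal{H}^G/\sum_{H<G}\mathrm{Tr}_H^G(\mathcal{H}^H)$, the sum being over the proper subgroups $H$ of $G$, where $\mathrm{Tr}_H^G(m)=\sum_{\sigma\in[G/H]}\sigma(m)$, and let $\mathrm{br}_G:\mathcal{H}^G\to\mathrm{Br}_G(\mathcal{H})$ be the canonical map. Then the elements $C_w$ ($w\in W$) and $C_w^G$ ($w\in W^G$) exist and are unique; there is a unique $A$-linear map $\mathrm{can}_G:\mathcal{H}_G\to\mathrm{Br}_G(\mathcal{H})$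 with $\mathrm{can}_G(T_w^G)=\mathrm{br}_G(T_w)$ for all $w\in W^G$; it is a surjective morphism of $A$-algebras with kernel $p\mathcal{H}_G$, so that $1\otimes h\mapsto\mathrm{can}_G(h)$ defines a ring isomorphism $\mathbb{F}_p\otimes_{\mathbb{Z}}\mathcal{H}_G\simeq\mathrm{Br}_G(\mathcal{H})$; and for all $w\in W^G$ one has $C_w\in\mathcal{H}^G$ and $\mathrm{can}_G(C_w^G)=\mathrm{br}_G(C_w)$. -/

import Mathlib

open scoped TensorProduct

/-! ## The Brauer quotient of an algebra with a group action -/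

/-- The element `∑ σ(m)`, where `σ` runs over a set of representatives of `G / H` (`G` finite).
For `m` fixed by `H` this is the relative trace `Tr_H^G(m)`. -/
noncomputable def relTrace {G M : Type*} [Group G] [Ring M] [MulSemiringAction G M]
    (H : Subgroup G) (m : M) : M :=
  ∑ᶠ q : G ⧸ H, q.out • m

/-- The elements `Tr_H^G(m)` of `M^G`, where `H` is a proper subgroup of `G` and `m ∈ M^H`. -/
def properTraces (R M G : Type*) [CommRing R] [Ring M] [Algebra R M] [Group G]
    [MulSemiringAction G M] [SMulCommClass G R M] : Set (FixedPoints.subalgebra R M G) :=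
  {t | ∃ H : Subgroup G, H < ⊤ ∧ ∃ m : M, (∀ h ∈ H, h • m = m) ∧ (t : M) = relTrace H m}

theorem relTrace_mul {G M : Type*} [Group G] [Finite G] [Ring M] [MulSemiringAction G M]
    (H : Subgroup G) (a m : M) (ha : ∀ g : G, g • a = a) :
    relTrace H (a * m) = a * relTrace H m := by
  simp only [relTrace, smul_mul', ha]
  exact (mul_finsum' _ a (Set.toFinite _)).symm

theorem relTrace_mul_right {G M : Type*} [Group G] [Finite G] [Ring M] [MulSemiringAction G M]
    (H : Subgroup G) (a m : M) (ha : ∀ g : G, g • a = a) :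
    relTrace H (m * a) = relTrace H m * a := by
  simp only [relTrace, smul_mul', ha]
  exact (finsum_mul' _ a (Set.toFinite _)).symm

/-- The two-sided ideal `Tr(M) = ∑_{H < G} Tr_H^G(M^H)` of `M^G`, the sum (of `R`-submodules)
being over the proper subgroups `H` of `G`. -/
noncomputable def traceIdeal (R M G : Type*) [CommRing R] [Ring M] [Algebra R M] [Group G]
    [Finite G] [MulSemiringAction G M] [SMulCommClass G R M] :
    Ideal (FixedPoints.subalgebra R M G) where
  __ := (Submodule.span R (properTraces R M G)).toAddSubmonoid
  smul_mem' := by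
    intro a x hx
    change a * x ∈ Submodule.span R (properTraces R M G)
    change x ∈ Submodule.span R (properTraces R M G) at hx
    induction hx using Submodule.span_induction with
    | mem x hx =>
      obtain ⟨H, hH, m, hm, hx⟩ := hx
      refine Submodule.subset_span ⟨H, hH, a * m, fun h hh => ?_, ?_⟩
      · rw [smul_mul', hm h hh, a.2 h]
      · rw [relTrace_mul H _ m a.2, ← hx]; rfl
    | zero => rw [mul_zero]; exact Submodule.zero_mem _
    | add x y _ _ hx hy => rw [mul_add]; exact Submodule.add_mem _ hx hy
    | smul r x _ hx => rw [mul_smul_comm]; exact Submodule.smul_mem _ r hx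

instance traceIdeal_isTwoSided (R M G : Type*) [CommRing R] [Ring M] [Algebra R M] [Group G]
    [Finite G] [MulSemiringAction G M] [SMulCommClass G R M] :
    (traceIdeal R M G).IsTwoSided where
  mul_mem_of_left := by
    intro x a hx
    change x * a ∈ Submodule.span R (properTraces R M G)
    change x ∈ Submodule.span R (properTraces R M G) at hx
    induction hx using Submodule.span_induction with
    | mem x hx =>
      obtain ⟨H, hH, m, hm, hx⟩ := hx
      refine Submodule.subset_span ⟨H, hH, m * a, fun h hh => ?_, ?_⟩
      · rw [smul_mul', hm h hh, a.2 h]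
      · rw [relTrace_mul_right H _ m a.2, ← hx]; rfl
    | zero => rw [zero_mul]; exact Submodule.zero_mem _
    | add x y _ _ hx hy => rw [add_mul]; exact Submodule.add_mem _ hx hy
    | smul r x _ hx => rw [smul_mul_assoc]; exact Submodule.smul_mem _ r hx

/-- The Brauer quotient `Br_G(M) = M^G / Tr(M)`, an `R`-algebra. -/
abbrev BrauerQuotient (R M G : Type*) [CommRing R] [Ring M] [Algebra R M] [Group G]
    [Finite G] [MulSemiringAction G M] [SMulCommClass G R M] : Type _ :=
  FixedPoints.subalgebra R M G ⧸ traceIdeal R M G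

/-- The canonical morphism `br_G : M^G → Br_G(M)`. -/
noncomputable def brauerMap (R M G : Type*) [CommRing R] [Ring M] [Algebra R M] [Group G]
    [Finite G] [MulSemiringAction G M] [SMulCommClass G R M] :
    FixedPoints.subalgebra R M G →ₐ[R] BrauerQuotient R M G :=
  Ideal.Quotient.mkₐ R (traceIdeal R M G)

/-! ## Length, weight functions and Hecke algebras

In this section `S` is a subset of a group `W`; the pair `(W, S)` is meant to be a Coxeter system,
but the definitions do not need this. -/

/-- The length `ℓ(w)` of `w` with respect to `S`: the smallest length of a word in `S` with
product `w`. -/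
noncomputable def wordLength {W : Type*} [Group W] (S : Set W) (w : W) : ℕ :=
  sInf {n | ∃ l : List W, (∀ s ∈ l, s ∈ S) ∧ l.prod = w ∧ l.length = n}

/-- Weight functions: `φ(ww') = φ(w) + φ(w')` whenever `ℓ(ww') = ℓ(w) + ℓ(w')`. -/
def IsWeightFunction {W Γ : Type*} [Group W] [AddCommGroup Γ] (S : Set W) (φ : W → Γ) : Prop :=
  ∀ w w' : W, wordLength S (w * w') = wordLength S w + wordLength S w' → φ (w * w') = φ w + φ w'

/-- The group algebra `A = ℤ[Γ]`. -/
abbrev WeightRing (Γ : Type*) [AddCommGroup Γ] : Type _ := AddMonoidAlgebra ℤ Γ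

/-- The basis element `e^γ` of `ℤ[Γ]`. -/
noncomputable abbrev expo {Γ : Type*} [AddCommGroup Γ] (γ : Γ) : WeightRing Γ :=
  AddMonoidAlgebra.single γ 1

/-- The defining relations of the Hecke algebra, between elements of the free `ℤ[Γ]`-algebra on
symbols `T_w`, `w ∈ W`. -/
inductive HeckeRel {W Γ : Type*} [Group W] [AddCommGroup Γ] (S : Set W) (φ : W → Γ) :
    FreeAlgebra (WeightRing Γ) W → FreeAlgebra (WeightRing Γ) W → Prop
  | one : HeckeRel S φ (FreeAlgebra.ι _ 1) 1
  | mul (w w' : W) (h : wordLength S (w * w') = wordLength S w + wordLength S w') :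
      HeckeRel S φ (FreeAlgebra.ι _ w * FreeAlgebra.ι _ w') (FreeAlgebra.ι _ (w * w'))
  | quad (s : W) (hs : s ∈ S) :
      HeckeRel S φ
        ((FreeAlgebra.ι _ s - algebraMap _ _ (expo (φ s))) *
          (FreeAlgebra.ι _ s + algebraMap _ _ (expo (-φ s)))) 0

/-- The Hecke algebra of `(W, S, Γ, φ)`: the `ℤ[Γ]`-algebra generated by elements `T_w` (`w ∈ W`)
subject to `T_1 = 1`, to `T_w T_w' = T_{ww'}` if `ℓ(ww') = ℓ(w) + ℓ(w')`, and to
`(T_s - e^{φ(s)})(T_s + e^{-φ(s)}) = 0` if `s ∈ S`. -/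
abbrev HeckeAlgebra {W Γ : Type*} [Group W] [AddCommGroup Γ] (S : Set W) (φ : W → Γ) : Type _ :=
  RingQuot (HeckeRel S φ)

/-- The standard element `T_w` of the Hecke algebra. -/
noncomputable def heckeT {W Γ : Type*} [Group W] [AddCommGroup Γ] (S : Set W) (φ : W → Γ)
    (w : W) : HeckeAlgebra S φ :=
  RingQuot.mkAlgHom (WeightRing Γ) (HeckeRel S φ) (FreeAlgebra.ι _ w)

/-- The additive subgroup `H_{<0} = ⊕_w A_{<0} T_w`, where `A_{<0} = ⊕_{γ < 0} ℤ e^γ`. -/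
noncomputable def heckeNeg {W Γ : Type*} [Group W] [AddCommGroup Γ] [LinearOrder Γ] (S : Set W) (φ : W → Γ) :
    AddSubgroup (HeckeAlgebra S φ) :=
  AddSubgroup.closure {h | ∃ (γ : Γ) (w : W), γ < 0 ∧ h = expo γ • heckeT S φ w}

/-- `b` is the bar involution of the Hecke algebra: an involutive ring endomorphism with
`e^γ ↦ e^{-γ}` and `T_w ↦ (T_{w⁻¹})⁻¹`. -/
structure IsBarInvolution {W Γ : Type*} [Group W] [AddCommGroup Γ] (S : Set W) (φ : W → Γ)
    (b : HeckeAlgebra S φ →+* HeckeAlgebra S φ) : Prop where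
  involutive : ∀ h, b (b h) = h
  expo : ∀ γ : Γ, b (algebraMap (WeightRing Γ) _ (expo γ)) =
    algebraMap (WeightRing Γ) _ (expo (-γ))
  mul_inv : ∀ w : W, b (heckeT S φ w) * heckeT S φ w⁻¹ = 1
  inv_mul : ∀ w : W, heckeT S φ w⁻¹ * b (heckeT S φ w) = 1

/-- `C` is the Kazhdan-Lusztig element `C_w`: it is fixed by the bar involution and
`C ≡ T_w mod H_{<0}`. -/
def IsKLElement {W Γ : Type*} [Group W] [AddCommGroup Γ] [LinearOrder Γ] (S : Set W) (φ : W → Γ)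
    (w : W) (C : HeckeAlgebra S φ) : Prop :=
  (∃ b, IsBarInvolution S φ b ∧ b C = C) ∧ C - heckeT S φ w ∈ heckeNeg S φ

/-! ## Automorphisms -/

/-- The group of automorphisms of `W` that stabilize `S` and `φ`. -/
def weightAut {W Γ : Type*} [Group W] (S : Set W) (φ : W → Γ) : Subgroup (MulAut W) where
  carrier := {σ | σ '' S = S ∧ ∀ w, φ (σ w) = φ w}
  one_mem' := ⟨by simp, fun w => rfl⟩
  mul_mem' := by
    rintro σ τ ⟨h1, h2⟩ ⟨h3, h4⟩
    refine ⟨?_, fun w => by rw [MulAut.mul_apply, h2, h4]⟩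
    rw [MulAut.coe_mul, Set.image_comp, h3, h1]
  inv_mem' := by
    rintro σ ⟨h1, h2⟩
    refine ⟨?_, fun w => by rw [← h2 (σ⁻¹ w), MulAut.apply_inv_self]⟩
    conv_lhs => rw [← h1]
    rw [← Set.image_comp, ← MulAut.coe_mul, inv_mul_cancel]
    simp

theorem wordLength_of_image {W : Type*} [Group W] (S : Set W) (σ : MulAut W)
    (h : σ '' S = S) (w : W) : wordLength S (σ w) = wordLength S w := by
  unfold wordLength
  congr 1
  ext n
  constructor
  · rintro ⟨l, hl, hp, hn⟩
    refine ⟨l.map σ.symm, ?_, ?_, by simpa using hn⟩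
    · intro s hs
      obtain ⟨t, ht, rfl⟩ := List.mem_map.1 hs
      have hu : t ∈ σ '' S := by rw [h]; exact hl t ht
      obtain ⟨u, hu, rfl⟩ := hu
      simpa using hu
    · rw [← map_list_prod, hp]; simp
  · rintro ⟨l, hl, hp, hn⟩
    refine ⟨l.map σ, ?_, ?_, by simpa using hn⟩
    · intro s hs
      obtain ⟨t, ht, rfl⟩ := List.mem_map.1 hs
      rw [← h]; exact Set.mem_image_of_mem σ (hl t ht)
    · rw [← map_list_prod, hp]

/-- The endomorphism `T_w ↦ T_{σ(w)}` of the Hecke algebra. -/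
noncomputable def heckeAct {W Γ : Type*} [Group W] [AddCommGroup Γ] (S : Set W) (φ : W → Γ)
    (σ : weightAut S φ) : HeckeAlgebra S φ →ₐ[WeightRing Γ] HeckeAlgebra S φ :=
  RingQuot.liftAlgHom (WeightRing Γ)
    ⟨FreeAlgebra.lift (WeightRing Γ) fun w => heckeT S φ (σ.1 w), by
      intro x y h
      induction h with
      | one =>
        simpa [heckeT] using RingQuot.mkAlgHom_rel (WeightRing Γ) (HeckeRel.one (S := S) (φ := φ))
      | mul w w' h =>
        have := RingQuot.mkAlgHom_rel (WeightRing Γ) (HeckeRel.mul (S := S) (φ := φ)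
          (σ.1 w) (σ.1 w') (by
            rw [← map_mul, wordLength_of_image S _ σ.2.1, wordLength_of_image S _ σ.2.1,
              wordLength_of_image S _ σ.2.1, h]))
        simpa [heckeT] using this
      | quad s hs =>
        have := RingQuot.mkAlgHom_rel (WeightRing Γ) (HeckeRel.quad (S := S) (φ := φ)
          (σ.1 s) (by
            have := Set.mem_image_of_mem σ.1 hs
            rwa [σ.2.1] at this))
        rw [σ.2.2] at this
        simpa only [heckeT, map_mul, map_sub, map_add, map_zero, FreeAlgebra.lift_ι_apply,
          AlgHom.commutes] using this⟩

theorem heckeAct_heckeT {W Γ : Type*} [Group W] [AddCommGroup Γ] (S : Set W) (φ : W → Γ)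
    (σ : weightAut S φ) (w : W) : heckeAct S φ σ (heckeT S φ w) = heckeT S φ (σ.1 w) := by
  simp [heckeAct, heckeT]

theorem hecke_algHom_ext {W Γ B : Type*} [Group W] [AddCommGroup Γ] {S : Set W} {φ : W → Γ}
    [Semiring B] [Algebra (WeightRing Γ) B] {f g : HeckeAlgebra S φ →ₐ[WeightRing Γ] B}
    (h : ∀ w, f (heckeT S φ w) = g (heckeT S φ w)) : f = g := by
  apply RingQuot.ringQuot_ext'
  ext w
  exact h w

/-- The action of the automorphisms of `(W, S, φ)` on the Hecke algebra: `σ(T_w) = T_{σ(w)}`. -/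
noncomputable instance heckeAction {W Γ : Type*} [Group W] [AddCommGroup Γ] (S : Set W)
    (φ : W → Γ) : MulSemiringAction (weightAut S φ) (HeckeAlgebra S φ) where
  smul σ h := heckeAct S φ σ h
  one_smul h := by
    change heckeAct S φ 1 h = h
    have : heckeAct S φ 1 = AlgHom.id _ _ :=
      hecke_algHom_ext fun w => by rw [heckeAct_heckeT]; rfl
    rw [this]; rfl
  mul_smul σ τ h := by
    change heckeAct S φ (σ * τ) h = heckeAct S φ σ (heckeAct S φ τ h)
    have : heckeAct S φ (σ * τ) = (heckeAct S φ σ).comp (heckeAct S φ τ) :=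
      hecke_algHom_ext fun w => by
        rw [AlgHom.comp_apply, heckeAct_heckeT, heckeAct_heckeT, heckeAct_heckeT]; rfl
    rw [this]; rfl
  smul_zero σ := map_zero (heckeAct S φ σ)
  smul_add σ := map_add (heckeAct S φ σ)
  smul_one σ := map_one (heckeAct S φ σ)
  smul_mul σ := map_mul (heckeAct S φ σ)

theorem smul_heckeT {W Γ : Type*} [Group W] [AddCommGroup Γ] (S : Set W) (φ : W → Γ)
    (σ : weightAut S φ) (w : W) : σ • heckeT S φ w = heckeT S φ (σ • w) :=
  heckeAct_heckeT S φ σ w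

instance heckeAction_comm {W Γ : Type*} [Group W] [AddCommGroup Γ] (S : Set W) (φ : W → Γ) :
    SMulCommClass (weightAut S φ) (WeightRing Γ) (HeckeAlgebra S φ) where
  smul_comm σ a h := map_smul (heckeAct S φ σ) a h

/-- The set `S_G` of the longest elements `s_ω` of the groups `W_ω = ⟨ω⟩`, where `ω` runs over the
`G`-orbits in `S` such that `W_ω` is finite, as a subset of `W^G`. -/
def fixedGenerators {W : Type*} [Group W] (S : Set W) (G : Type*) [Group G]
    [MulDistribMulAction G W] : Set (FixedPoints.subgroup G W) :=
  {x | ∃ s ∈ S, (Subgroup.closure (MulAction.orbit G s) : Set W).Finite ∧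
    (x : W) ∈ Subgroup.closure (MulAction.orbit G s) ∧
    ∀ w ∈ Subgroup.closure (MulAction.orbit G s), wordLength S w ≤ wordLength S (x : W)}

/-- The restriction `φ_G` of `φ` to `W^G`. -/
def fixedWeight {W Γ : Type*} [Group W] (φ : W → Γ) (G : Type*) [Group G]
    [MulDistribMulAction G W] : FixedPoints.subgroup G W → Γ :=
  fun w => φ w

/-- The element `T_w` of `H^G`, for `w ∈ W^G`. -/
noncomputable def fixedT {W Γ : Type*} [Group W] [AddCommGroup Γ] (S : Set W) (φ : W → Γ)
    (G : Subgroup (weightAut S φ)) (w : FixedPoints.subgroup G W) :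
    FixedPoints.subalgebra (WeightRing Γ) (HeckeAlgebra S φ) G :=
  ⟨heckeT S φ w, fun g => by
    have h := smul_heckeT S φ g.1 w
    have h' : g.1 • (w : W) = w := w.2 g
    rw [h'] at h
    exact h⟩

/-! The proof has a combinatorial half and a modular half.

Combinatorics. Everything about Coxeter groups is drawn from the folding condition: if `s * w` is
longer than `w` but `s * (w * t)` is shorter than `w * t`, then `s * w = w * t`. It yields the
exchange condition, and it is robust. For a Coxeter system it follows from a cocycle counting
inversions modulo two (`CoxeterSystem.fold_right`). The length of `W`, restricted to `W^G` and taken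
relative to `S_G`, satisfies it again (`IsFoldingLength.fixedPoints`), as a weighted length.
Whenever the word length for `S_G` is additive on a product, so is the length of `W`
(`IsFoldingLength.additive`). Hence `φ_G` is a weight function, and the standard basis, the bar
involution and the Kazhdan-Lusztig elements can be constructed once, from folding alone, for both
algebras. No Coxeter presentation of `W^G` is needed.

Brauer quotient. The group `G` permutes the basis `T_w`. Proper subgroups of a `p`-group have index
divisible by `p`, so a trace has coefficients divisible by `p` at fixed `w`. Conversely, orbit sums
over nontrivial orbits are traces from stabilizers, and `p T_w` for fixed `w` is a trace from a
subgroup of index `p`. So the trace ideal is cut out by divisibility by `p` at the fixed points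
(`mem_traceIdeal_iff`), which gives surjectivity and the kernel of `can_G`. For multiplicativity the
only delicate relation is the quadratic one (`brauerMap_fixedT_sq`): the fixed elements of `W_ω` are
`1` and `s_ω`, so modulo traces the square of `T_{s_ω}` is `1 + c T_{s_ω}`, and the invariant
character `T_w ↦ e^{φ(w)}` determines `c` modulo `p`.

Kazhdan-Lusztig elements. The bar involutions are compatible with `can_G` (`brauerLift_bar`). The
part of `C_w` supported on `W^G` differs from `C_w^G` by an element of `H_{<0}` that is bar
invariant modulo `p`, and such an element is divisible by `p` (`exists_nsmul_of_neg`). The same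
lemma modulo `0` gives uniqueness of the Kazhdan-Lusztig elements. -/

/-! ## Length functions with the folding property -/

/-- `L` is a (weighted) length function on `W` relative to a set `S` of involutions, for which the
folding condition, equivalent to the exchange condition, holds. -/
structure IsFoldingLength {W : Type*} [Group W] (S : Set W) (L : W → ℕ) : Prop where
  one : L 1 = 0
  inv : ∀ w, L w⁻¹ = L w
  sq : ∀ s ∈ S, s * s = 1
  pos : ∀ s ∈ S, 0 < L s
  step : ∀ s ∈ S, ∀ w, L (s * w) = L w + L s ∨ L (s * w) + L s = L w
  desc : ∀ w ≠ 1, ∃ s ∈ S, L (s * w) < L w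
  fold : ∀ s ∈ S, ∀ t ∈ S, ∀ w, L w < L (s * w) → L (s * (w * t)) < L (w * t) → s * w = w * t

namespace IsFoldingLength

variable {W : Type*} [Group W] {S : Set W} {L : W → ℕ}

theorem inv_eq (h : IsFoldingLength S L) {s : W} (hs : s ∈ S) : s⁻¹ = s :=
  inv_eq_of_mul_eq_one_right (h.sq s hs)

theorem cancel (h : IsFoldingLength S L) {s : W} (hs : s ∈ S) (w : W) : s * (s * w) = w := by
  rw [← mul_assoc, h.sq s hs, one_mul]

theorem cancel_right (h : IsFoldingLength S L) {s : W} (hs : s ∈ S) (w : W) : w * s * s = w := by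
  rw [mul_assoc, h.sq s hs, mul_one]

theorem length_mul_right (h : IsFoldingLength S L) {s : W} (hs : s ∈ S) (w : W) :
    L (w * s) = L (s * w⁻¹) := by
  rw [← h.inv, mul_inv_rev, h.inv_eq hs]

theorem step_right (h : IsFoldingLength S L) {s : W} (hs : s ∈ S) (w : W) :
    L (w * s) = L w + L s ∨ L (w * s) + L s = L w := by
  rw [h.length_mul_right hs, ← h.inv w]
  exact h.step s hs w⁻¹

theorem lt_or_lt (h : IsFoldingLength S L) {s : W} (hs : s ∈ S) (w : W) :
    L w < L (s * w) ∨ L (s * w) < L w := by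
  have := h.step s hs w
  have := h.pos s hs
  omega

theorem desc_right (h : IsFoldingLength S L) {w : W} (hw : w ≠ 1) : ∃ s ∈ S, L (w * s) < L w := by
  obtain ⟨s, hs, hlt⟩ := h.desc w⁻¹ (by simpa using hw)
  exact ⟨s, hs, by rwa [h.length_mul_right hs, ← h.inv w]⟩

theorem exists_word (h : IsFoldingLength S L) (w : W) :
    ∃ l : List W, (∀ s ∈ l, s ∈ S) ∧ l.prod = w := by
  induction hn : L w using Nat.strong_induction_on generalizing w with
  | _ n ih =>
    by_cases hw : w = 1
    · exact ⟨[], by simp, by simp [hw]⟩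
    · obtain ⟨s, hs, hlt⟩ := h.desc w hw
      obtain ⟨l, hl, hp⟩ := ih _ (hn ▸ hlt) (s * w) rfl
      exact ⟨s :: l, by simpa [hs] using hl, by rw [List.prod_cons, hp, h.cancel hs]⟩

/-- The exchange condition, relative to a prefix `u`. -/
theorem exchange (h : IsFoldingLength S L) {s : W} (hs : s ∈ S) (l : List W) (hl : ∀ t ∈ l, t ∈ S)
    (u : W) (h1 : L u < L (s * u)) (h2 : L (s * (u * l.prod)) < L (u * l.prod)) :
    ∃ l₁ t l₂, l = l₁ ++ t :: l₂ ∧ s * (u * l₁.prod) = u * l₁.prod * t := by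
  induction l generalizing u with
  | nil => simp at h2; omega
  | cons t l ih =>
    rcases h.lt_or_lt hs (u * t) with hlt | hlt
    · obtain ⟨l₁, t', l₂, rfl, heq⟩ := ih (fun x hx => hl x (by simp [hx])) (u * t) hlt
        (by simpa [mul_assoc] using h2)
      exact ⟨t :: l₁, t', l₂, rfl, by simpa [mul_assoc] using heq⟩
    · exact ⟨[], t, l, rfl, by simpa using h.fold s hs t (hl t (by simp)) u h1 hlt⟩

theorem exchange_one (h : IsFoldingLength S L) {s : W} (hs : s ∈ S) (l : List W)
    (hl : ∀ t ∈ l, t ∈ S) (h2 : L (s * l.prod) < L l.prod) :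
    ∃ l₁ t l₂, l = l₁ ++ t :: l₂ ∧ s * l₁.prod = l₁.prod * t := by
  obtain ⟨l₁, t, l₂, e, e'⟩ := h.exchange hs l hl 1 (by simpa [h.one] using h.pos s hs)
    (by simpa using h2)
  exact ⟨l₁, t, l₂, e, by simpa using e'⟩

theorem mul_prod_of_exchange (h : IsFoldingLength S L) {s t : W} (ht : t ∈ S) (u : W)
    (l₁ l₂ : List W) (heq : s * (u * l₁.prod) = u * l₁.prod * t) :
    s * (u * (l₁ ++ t :: l₂).prod) = u * (l₁ ++ l₂).prod := by
  have : s * (u * (l₁ ++ t :: l₂).prod) = s * (u * l₁.prod) * (t * l₂.prod) := by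
    simp [mul_assoc]
  rw [this, heq]
  simp [mul_assoc, h.cancel ht]

theorem wordLength_le {l : List W} (hl : ∀ s ∈ l, s ∈ S) : wordLength S l.prod ≤ l.length :=
  Nat.sInf_le ⟨l, hl, rfl, rfl⟩

theorem exists_reduced (h : IsFoldingLength S L) (w : W) :
    ∃ l : List W, (∀ s ∈ l, s ∈ S) ∧ l.prod = w ∧ l.length = wordLength S w := by
  obtain ⟨l, hl, hp⟩ := h.exists_word w
  exact Nat.sInf_mem (s := {n | ∃ l : List W, (∀ s ∈ l, s ∈ S) ∧ l.prod = w ∧ l.length = n})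
    ⟨l.length, l, hl, hp, rfl⟩

theorem wordLength_mul_le (h : IsFoldingLength S L) {s : W} (hs : s ∈ S) (w : W) :
    wordLength S (s * w) ≤ wordLength S w + 1 := by
  obtain ⟨l, hl, rfl, hn⟩ := h.exists_reduced w
  have := wordLength_le (S := S) (l := s :: l) (by simpa [hs] using hl)
  simpa [hn] using this

/-- Exchange deletes a letter from a reduced word of `w`. So `L` and the word length have the same
descents, although `L` may jump by more than one. -/
theorem wordLength_lt (h : IsFoldingLength S L) {s : W} (hs : s ∈ S) {w : W}
    (hlt : L (s * w) < L w) : wordLength S (s * w) < wordLength S w := by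
  obtain ⟨l, hl, rfl, hn⟩ := h.exists_reduced w
  obtain ⟨l₁, t, l₂, rfl, heq⟩ := h.exchange_one hs l hl hlt
  have := h.mul_prod_of_exchange (hl t (by simp)) 1 l₁ l₂ (by simpa using heq)
  rw [one_mul, one_mul] at this
  rw [this, ← hn]
  have := wordLength_le (S := S) (l := l₁ ++ l₂) (fun s hs => hl s (by simp at hs ⊢; tauto))
  simp at this ⊢
  omega

theorem wordLength_lt_iff (h : IsFoldingLength S L) {s : W} (hs : s ∈ S) (w : W) :
    wordLength S (s * w) < wordLength S w ↔ L (s * w) < L w := by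
  refine ⟨fun hlt => ?_, h.wordLength_lt hs⟩
  rcases h.lt_or_lt hs w with h1 | h1
  · have := h.wordLength_lt hs (w := s * w) (by rwa [h.cancel hs])
    rw [h.cancel hs] at this
    omega
  · exact h1

theorem wordLength_step (h : IsFoldingLength S L) {s : W} (hs : s ∈ S) (w : W) :
    wordLength S (s * w) = wordLength S w + 1 ∨ wordLength S (s * w) + 1 = wordLength S w := by
  have h1 := h.wordLength_mul_le hs w
  have h2 := h.wordLength_mul_le hs (s * w)
  rw [h.cancel hs] at h2
  rcases h.lt_or_lt hs w with h3 | h3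
  · have := h.wordLength_lt hs (w := s * w) (by rwa [h.cancel hs])
    rw [h.cancel hs] at this
    omega
  · have := h.wordLength_lt hs h3
    omega

theorem lt_wordLength_iff (h : IsFoldingLength S L) {s : W} (hs : s ∈ S) (w : W) :
    wordLength S w < wordLength S (s * w) ↔ L w < L (s * w) := by
  have h1 := h.wordLength_lt_iff hs w
  have h2 := h.wordLength_step hs w
  have h3 := h.lt_or_lt hs w
  omega

theorem wordLength_one : wordLength S (1 : W) = 0 :=
  Nat.le_zero.1 (wordLength_le (S := S) (l := []) (by simp))

theorem wordLength_inv_le (h : IsFoldingLength S L) (w : W) :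
    wordLength S w⁻¹ ≤ wordLength S w := by
  obtain ⟨l, hl, rfl, hn⟩ := h.exists_reduced w
  rw [← hn, List.prod_inv_reverse]
  refine (wordLength_le (S := S) fun s hs => ?_).trans (by simp)
  simp only [List.mem_reverse, List.mem_map] at hs
  obtain ⟨t, ht, rfl⟩ := hs
  rw [h.inv_eq (hl t ht)]
  exact hl t ht

theorem wordLength_simple (h : IsFoldingLength S L) {s : W} (hs : s ∈ S) : wordLength S s = 1 := by
  have := h.wordLength_step hs 1
  rw [wordLength_one, mul_one] at this
  omega

/-- The word length is itself a length function with the folding property. -/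
theorem wordLength (h : IsFoldingLength S L) : IsFoldingLength S (wordLength S) where
  one := wordLength_one
  inv w := le_antisymm (h.wordLength_inv_le w) (by simpa using h.wordLength_inv_le w⁻¹)
  sq := h.sq
  pos s hs := by rw [h.wordLength_simple hs]; exact one_pos
  step s hs w := by rw [h.wordLength_simple hs]; exact h.wordLength_step hs w
  desc w hw := by
    obtain ⟨s, hs, hlt⟩ := h.desc w hw
    exact ⟨s, hs, h.wordLength_lt hs hlt⟩
  fold s hs t ht w h1 h2 :=
    h.fold s hs t ht w ((h.lt_wordLength_iff hs w).1 h1) ((h.wordLength_lt_iff hs _).1 h2)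

theorem wordLength_mul_le_add (h : IsFoldingLength S L) (v w : W) :
    _root_.wordLength S (v * w) ≤ _root_.wordLength S v + _root_.wordLength S w := by
  obtain ⟨l, hl, rfl, hn⟩ := h.exists_reduced v
  obtain ⟨l', hl', rfl, hn'⟩ := h.exists_reduced w
  rw [← hn, ← hn', ← List.prod_append, ← List.length_append]
  exact wordLength_le fun s hs => by
    rcases List.mem_append.1 hs with hs | hs
    · exact hl s hs
    · exact hl' s hs

/-- Products along which the word length is additive can be peeled off on the left. -/
theorem additive_peel (h : IsFoldingLength S L) {s v w : W} (hs : s ∈ S)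
    (hv : _root_.wordLength S (s * v) < _root_.wordLength S v)
    (hadd : _root_.wordLength S (v * w) = _root_.wordLength S v + _root_.wordLength S w) :
    _root_.wordLength S (s * v * w) = _root_.wordLength S (s * v) + _root_.wordLength S w ∧
      _root_.wordLength S (s * v * w) < _root_.wordLength S (v * w) := by
  have h1 := h.wordLength_mul_le_add (s * v) w
  have h2 := h.wordLength_step hs (v * w)
  have h3 := h.wordLength_step hs v
  rw [← mul_assoc] at h2
  omega

/-- Where the word length is additive, so is `L`. -/
theorem additive (h : IsFoldingLength S L) (v w : W)
    (hadd : _root_.wordLength S (v * w) = _root_.wordLength S v + _root_.wordLength S w) :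
    L (v * w) = L v + L w := by
  induction hn : _root_.wordLength S v using Nat.strong_induction_on generalizing v with
  | _ n ih =>
    by_cases hv : v = 1
    · simp [hv, h.one]
    · obtain ⟨s, hs, hlt⟩ := h.wordLength.desc v hv
      obtain ⟨h1, h2⟩ := h.additive_peel hs hlt hadd
      have h3 := ih _ (hn ▸ hlt) _ h1 rfl
      rw [mul_assoc] at h2 h3
      -- Descents for the word length are descents for `L`, so `L v` and `L (v * w)` both drop by
      -- the same amount `L s`.
      rw [h.wordLength_lt_iff hs] at h2 hlt
      have h4 := h.step s hs v
      have h5 := h.step s hs (v * w)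
      have h6 := h.pos s hs
      omega

end IsFoldingLength

/-! ## Coxeter groups -/

namespace CoxeterSystem

variable {B W : Type*} [Group W] {M : CoxeterMatrix B} (cs : CoxeterSystem M W)

theorem _root_.Function.End.mul_apply' {X : Type*} (f g : Function.End X) (x : X) :
    (f * g) x = f (g x) := rfl

theorem _root_.Function.End.one_apply' {X : Type*} (x : X) : (1 : Function.End X) x = x := rfl

open Classical in
/-- The action of a simple reflection on `W × ℤ/2`, which counts how often an element occurs as an
inversion, modulo two. -/
noncomputable def inversionStep (i : B) : Function.End (W × ZMod 2) :=
  fun x => (cs.simple i * x.1 * cs.simple i, x.2 + if x.1 = cs.simple i then 1 else 0)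

theorem simple_mul_pow_conj (i j : B) (l : ℕ) :
    cs.simple j * (cs.simple i * cs.simple j) ^ l =
      ((cs.simple i * cs.simple j) ^ l)⁻¹ * cs.simple j := by
  induction l with
  | zero => simp
  | succ l ih =>
    rw [pow_succ, ← mul_assoc, ih]
    rw [← pow_succ, pow_succ', mul_inv_rev, mul_assoc, mul_assoc]
    simp [mul_assoc]

-- Each simple step tests whether the current conjugate of `r` is the simple reflection. Transported
-- back to `r`, the `2k` tests compare `r` with the reflections `u⁻ⁿ s_j` for `n < 2k`, where `u =
-- s_i s_j`.
open Classical in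
theorem inversionStep_pow (i j : B) (k : ℕ) (r : W) (z : ZMod 2) :
    ((cs.inversionStep i * cs.inversionStep j) ^ k) (r, z) =
      ((cs.simple i * cs.simple j) ^ k * r * ((cs.simple i * cs.simple j) ^ k)⁻¹,
        z + ∑ n ∈ Finset.range (2 * k),
          if r = ((cs.simple i * cs.simple j) ^ n)⁻¹ * cs.simple j then 1 else 0) := by
  induction k with
  | zero => simp [Function.End.one_apply']
  | succ k ih =>
    set u := cs.simple i * cs.simple j with hu
    rw [pow_succ', Function.End.mul_apply', ih, Nat.mul_succ,
      Finset.sum_range_succ, Finset.sum_range_succ, Function.End.mul_apply']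
    have huinv : u⁻¹ = cs.simple j * cs.simple i := by simp [hu]
    have e1 : (u ^ k * r * (u ^ k)⁻¹ = cs.simple j) ↔ r = (u ^ (2 * k))⁻¹ * cs.simple j := by
      rw [mul_inv_eq_iff_eq_mul, cs.simple_mul_pow_conj, ← eq_inv_mul_iff_mul_eq, two_mul, pow_add,
        mul_inv_rev, mul_assoc]
    have e2 : (cs.simple j * (u ^ k * r * (u ^ k)⁻¹) * cs.simple j = cs.simple i) ↔
        r = (u ^ (2 * k + 1))⁻¹ * cs.simple j := by
      have : (cs.simple j * (u ^ k * r * (u ^ k)⁻¹) * cs.simple j = cs.simple i) ↔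
          u ^ k * r * (u ^ k)⁻¹ = u⁻¹ * cs.simple j := by
        rw [huinv]
        constructor
        · intro h; rw [← h]; simp [mul_assoc]
        · intro h; rw [h]; simp [mul_assoc]
      rw [this, mul_inv_eq_iff_eq_mul, mul_assoc, cs.simple_mul_pow_conj, ← eq_inv_mul_iff_mul_eq,
        show 2 * k + 1 = k + 1 + k by ring, pow_add, pow_add, pow_one, mul_inv_rev (u ^ k * u),
        mul_inv_rev (u ^ k) u, ← hu]
      simp only [mul_assoc]
    simp only [inversionStep, e1, e2]
    refine Prod.ext ?_ ?_
    · simp [pow_succ', hu, mul_assoc]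
    · simp only [add_assoc]

/-- If `m` is the Coxeter entry, then `u ^ m = 1`, so the list of `2m` reflections runs twice
through its first half and every count is even. The entry `0`, meaning no relation, is covered too.
-/
theorem inversionStep_isLiftable : M.IsLiftable cs.inversionStep := by
  classical
  intro i j
  refine funext fun x => ?_
  obtain ⟨r, z⟩ := x
  rw [cs.inversionStep_pow, cs.simple_mul_simple_pow, two_mul, Finset.sum_range_add]
  simp only [pow_add, cs.simple_mul_simple_pow, one_mul, inv_one, mul_one, Function.End.one_apply']
  rw [CharTwo.add_self_eq_zero, add_zero]

/-- The number of times, modulo two, that `r` occurs as an inversion of `w⁻¹`. -/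
noncomputable def inversionParity (w r : W) : ZMod 2 :=
  (cs.lift ⟨cs.inversionStep, cs.inversionStep_isLiftable⟩ w (r, 0)).2

theorem lift_inversionStep (w r : W) (z : ZMod 2) :
    cs.lift ⟨cs.inversionStep, cs.inversionStep_isLiftable⟩ w (r, z) =
      (w * r * w⁻¹, z + cs.inversionParity w r) := by
  induction w using cs.simple_induction_left generalizing r z with
  | one => simp [inversionParity, Function.End.one_apply']
  | mul_simple_left w i ih =>
    have key : ∀ z, cs.lift ⟨cs.inversionStep, cs.inversionStep_isLiftable⟩ (cs.simple i * w) (r, z)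
        = cs.inversionStep i (w * r * w⁻¹, z + cs.inversionParity w r) := by
      intro z
      rw [map_mul, lift_apply_simple, Function.End.mul_apply', ih]
    rw [inversionParity, key, key]
    simp [inversionStep, mul_assoc, add_assoc]

theorem inversionParity_mul (v w r : W) :
    cs.inversionParity (v * w) r = cs.inversionParity w r + cs.inversionParity v (w * r * w⁻¹) := by
  have h := cs.lift_inversionStep (v * w) r 0
  rw [map_mul, Function.End.mul_apply', lift_inversionStep,
    lift_inversionStep] at h
  simpa using (congrArg Prod.snd h).symm

open Classical in
theorem inversionParity_simple (i : B) (r : W) :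
    cs.inversionParity (cs.simple i) r = if r = cs.simple i then 1 else 0 := by
  rw [inversionParity, lift_apply_simple, inversionStep, zero_add]

/-- By the cocycle identity the parity of a word adds up, modulo two, the occurrences of `r` in its
right inversion sequence. An odd count is not zero. -/
theorem mem_rightInvSeq_of_inversionParity (l : List B) (r : W)
    (h : cs.inversionParity (cs.wordProd l) r ≠ 0) : r ∈ cs.rightInvSeq l := by
  classical
  induction l with
  | nil =>
    have := cs.inversionParity_mul 1 1 r
    simp at this
    simp [this] at h
  | cons i l ih =>
    rw [wordProd_cons, inversionParity_mul, inversionParity_simple] at h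
    rw [rightInvSeq, List.mem_cons]
    by_cases h1 : cs.inversionParity (cs.wordProd l) r = 0
    · left
      rw [h1, zero_add] at h
      have : cs.wordProd l * r * (cs.wordProd l)⁻¹ = cs.simple i := by
        by_contra hne
        simp [hne] at h
      rw [← this]
      group
    · exact Or.inr (ih h1)

theorem isRightDescent_of_inversionParity (w : W) (i : B)
    (h : cs.inversionParity w (cs.simple i) ≠ 0) : cs.length (w * cs.simple i) < cs.length w := by
  obtain ⟨l, hl, rfl⟩ := cs.exists_isReduced w
  exact (cs.isRightInversion_of_mem_rightInvSeq hl
    (cs.mem_rightInvSeq_of_inversionParity l _ h)).2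

theorem inversionParity_mul_simple (w : W) (i : B) :
    cs.inversionParity (w * cs.simple i) (cs.simple i) =
      1 + cs.inversionParity w (cs.simple i) := by
  classical
  rw [inversionParity_mul, inversionParity_simple]
  simp

/-- Multiplication by `s_i` on the right flips the parity at `s_i`, so even parity for `w` means odd
parity, hence a descent, for `w * s_i`. -/
theorem isRightDescent_iff_inversionParity (w : W) (i : B) :
    cs.length (w * cs.simple i) < cs.length w ↔ cs.inversionParity w (cs.simple i) ≠ 0 := by
  refine ⟨fun h h0 => ?_, cs.isRightDescent_of_inversionParity w i⟩
  have := cs.isRightDescent_of_inversionParity (w * cs.simple i) i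
    (by rw [inversionParity_mul_simple, h0]; simp)
  rw [simple_mul_simple_cancel_right] at this
  omega

/-- Passing from `w` to `s_j * w` changes the parity at `s_i` only if `w s_i w⁻¹ = s_j`, by the
cocycle identity. The hypotheses say that it does change. -/
theorem fold_right (w : W) (i j : B) (h1 : cs.length w < cs.length (w * cs.simple i))
    (h2 : cs.length (cs.simple j * w * cs.simple i) < cs.length (cs.simple j * w)) :
    cs.simple j * w = w * cs.simple i := by
  classical
  rw [isRightDescent_iff_inversionParity, inversionParity_mul, inversionParity_simple] at h2
  have h3 : cs.inversionParity w (cs.simple i) = 0 := by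
    by_contra h
    have := cs.isRightDescent_of_inversionParity w i h
    omega
  rw [h3, zero_add] at h2
  have : w * cs.simple i * w⁻¹ = cs.simple j := by
    by_contra hne
    simp [hne] at h2
  rw [← this]
  simp

/-- The length function of a Coxeter system has the folding property. -/
theorem isFoldingLength : IsFoldingLength (Set.range cs.simple) cs.length where
  one := cs.length_one
  inv := cs.length_inv
  sq := by rintro _ ⟨i, rfl⟩; exact cs.simple_mul_simple_self i
  pos := by rintro _ ⟨i, rfl⟩; rw [length_simple]; exact one_pos
  step := by rintro _ ⟨i, rfl⟩ w; rw [length_simple]; exact cs.length_simple_mul w i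
  desc w hw := by
    obtain ⟨i, hi⟩ := cs.exists_leftDescent_of_ne_one hw
    exact ⟨_, ⟨i, rfl⟩, hi⟩
  fold := by
    rintro _ ⟨i, rfl⟩ _ ⟨j, rfl⟩ w h1 h2
    have h := cs.fold_right w⁻¹ i j
    have e1 : w⁻¹ * cs.simple i = (cs.simple i * w)⁻¹ := by simp
    have e2 : cs.simple j * w⁻¹ = (w * cs.simple j)⁻¹ := by simp
    have e3 : cs.simple j * w⁻¹ * cs.simple i = (cs.simple i * (w * cs.simple j))⁻¹ := by
      simp [mul_assoc]
    rw [e3, e1, e2] at h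
    simp only [length_inv, inv_inj] at h
    exact (h h1 h2).symm

end CoxeterSystem

/-! ## Parabolic subgroups -/

namespace IsFoldingLength

variable {W : Type*} [Group W] {S : Set W}

local notation "ℓ" => _root_.wordLength

theorem length_mul_le (h : IsFoldingLength S (ℓ S)) (v w : W) : ℓ S (v * w) ≤ ℓ S v + ℓ S w :=
  h.wordLength_mul_le_add v w

theorem length_eq_zero (h : IsFoldingLength S (ℓ S)) {w : W} (hw : ℓ S w = 0) : w = 1 := by
  by_contra hne
  obtain ⟨s, -, hlt⟩ := h.desc w hne
  omega

theorem finite_length_le (h : IsFoldingLength S (ℓ S)) (hS : S.Finite) (n : ℕ) :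
    {w : W | ℓ S w ≤ n}.Finite := by
  have := hS.to_subtype
  refine ((List.finite_length_le S n).image fun l : List S => (l.map Subtype.val).prod).subset ?_
  intro w hw
  obtain ⟨l, hl, hp, hn⟩ := h.exists_reduced w
  refine ⟨l.attach.map fun x => ⟨x.1, hl _ x.2⟩, ?_, ?_⟩
  · simpa [hn] using hw
  · simpa [Function.comp_def] using hp

variable {I : Set W}

/-- The elements of a parabolic subgroup `⟨I⟩` have reduced words in `I`. -/
theorem exists_reduced_parabolic (h : IsFoldingLength S (ℓ S)) (hI : I ⊆ S) {w : W}
    (hw : w ∈ Subgroup.closure I) :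
    ∃ l : List W, (∀ s ∈ l, s ∈ I) ∧ l.prod = w ∧ l.length = ℓ S w := by
  have key : ∀ t ∈ I, ∀ w : W, (∃ l : List W, (∀ s ∈ l, s ∈ I) ∧ l.prod = w ∧ l.length = ℓ S w) →
      ∃ l : List W, (∀ s ∈ l, s ∈ I) ∧ l.prod = t * w ∧ l.length = ℓ S (t * w) := by
    rintro t ht w ⟨l, hl, rfl, hn⟩
    rcases h.wordLength_step (hI ht) l.prod with hs | hs
    · exact ⟨t :: l, by simpa [ht] using hl, by simp, by simp [hs, hn]⟩
    · obtain ⟨l₁, t', l₂, rfl, heq⟩ := h.exchange_one (hI ht) l (fun s hs => hI (hl s hs)) (by omega)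
      have := h.mul_prod_of_exchange (hI (hl t' (by simp))) 1 l₁ l₂ (by simpa using heq)
      rw [one_mul, one_mul] at this
      refine ⟨l₁ ++ l₂, fun s hs => hl s (by simp at hs ⊢; tauto), this.symm, ?_⟩
      simp only [List.length_append, List.length_cons] at hn ⊢
      omega
  induction hw using Subgroup.closure_induction_left with
  | one => exact ⟨[], by simp, by simp, by simp [wordLength_one]⟩
  | mul_left t ht w _ ih => exact key t ht w ih
  | inv_mul_cancel t ht w _ ih => rw [h.inv_eq (hI ht)]; exact key t ht w ih

theorem exists_desc_parabolic (h : IsFoldingLength S (ℓ S)) (hI : I ⊆ S) {w : W}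
    (hw : w ∈ Subgroup.closure I) (hne : w ≠ 1) : ∃ s ∈ I, ℓ S (s * w) < ℓ S w := by
  obtain ⟨l, hl, rfl, hn⟩ := h.exists_reduced_parabolic hI hw
  cases l with
  | nil => simp at hne
  | cons s l =>
    refine ⟨s, hl s (by simp), ?_⟩
    rw [← hn, List.prod_cons, h.cancel (hI (hl s (by simp)))]
    have := wordLength_le (S := S) (l := l) (fun s hs => hI (hl s (by simp [hs])))
    simp
    omega

theorem mem_of_length_one (h : IsFoldingLength S (ℓ S)) (hI : I ⊆ S) {w : W}
    (hw : w ∈ Subgroup.closure I) (h1 : ℓ S w = 1) : w ∈ I := by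
  obtain ⟨l, hl, rfl, hn⟩ := h.exists_reduced_parabolic hI hw
  obtain ⟨s, rfl⟩ := List.length_eq_one_iff.1 (hn.trans h1)
  simpa using hl s (by simp)

/-- Elements without left descents in `I` are minimal in their right coset modulo `⟨I⟩`, and the
length is additive. -/
theorem length_mul_of_no_desc (h : IsFoldingLength S (ℓ S)) (hI : I ⊆ S) {w : W}
    (hw : ∀ s ∈ I, ℓ S w < ℓ S (s * w)) {y : W} (hy : y ∈ Subgroup.closure I) :
    ℓ S (y * w) = ℓ S y + ℓ S w := by
  -- Additivity is proved first for a shortest element of the coset. If it failed, exchange would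
  -- delete a letter from a reduced word of `w'` and produce a shorter element of the same coset.
  have add_of_min : ∀ w' : W, (∀ y ∈ Subgroup.closure I, ℓ S w' ≤ ℓ S (y * w')) →
      ∀ y ∈ Subgroup.closure I, ℓ S (y * w') = ℓ S y + ℓ S w' := by
    intro w' hmin y hy
    induction hn : ℓ S y using Nat.strong_induction_on generalizing y with
    | _ n ih =>
      by_cases hy1 : y = 1
      · subst hy1; simp [← hn, wordLength_one]
      · obtain ⟨s, hs, hlt⟩ := h.exists_desc_parabolic hI hy hy1
        have hsy := mul_mem (Subgroup.subset_closure hs) hy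
        have h1 := ih _ (hn ▸ hlt) (s * y) hsy rfl
        have h2 := h.wordLength_step (hI hs) y
        rcases h.wordLength_step (hI hs) (s * y * w') with h3 | h3
        · rw [mul_assoc, h.cancel (hI hs)] at h3
          rw [mul_assoc] at h1
          omega
        · obtain ⟨l, hl, hp, hl'⟩ := h.exists_reduced w'
          obtain ⟨l₁, t, l₂, rfl, heq⟩ := h.exchange (hI hs) l hl (s * y)
            (by rw [h.cancel (hI hs)]; omega) (by rw [hp]; omega)
          have h4 := h.mul_prod_of_exchange (hl t (by simp)) (s * y) l₁ l₂ heq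
          rw [hp] at h4
          have h5 := wordLength_le (S := S) (l := l₁ ++ l₂)
            (fun s hs => hl s (by simp at hs ⊢; tauto))
          have h6 := hmin ((s * y)⁻¹ * (s * (s * y)))
            (mul_mem (inv_mem hsy) (mul_mem (Subgroup.subset_closure hs) hsy))
          have h7 : (s * y)⁻¹ * (s * (s * y)) * w' = (l₁ ++ l₂).prod := by
            rw [mul_assoc, inv_mul_eq_iff_eq_mul, ← h4, mul_assoc, mul_assoc]
          rw [h7] at h6
          simp only [List.length_append, List.length_cons] at hl' h5
          omega
  obtain ⟨x, hx, hmin⟩ : ∃ x ∈ Subgroup.closure I, ∀ y ∈ Subgroup.closure I,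
      ℓ S (x * w) ≤ ℓ S (y * w) := by
    obtain ⟨x, hx, hx'⟩ := Nat.sInf_mem
      (s := (fun y => ℓ S (y * w)) '' (Subgroup.closure I : Set W)) ⟨_, 1, one_mem _, rfl⟩
    exact ⟨x, hx, fun y hy => hx'.trans_le (Nat.sInf_le ⟨y, hy, rfl⟩)⟩
  have hadd := add_of_min (x * w) fun y hy => by
    rw [← mul_assoc]; exact hmin _ (mul_mem hy hx)
  by_cases hx1 : x = 1
  · subst hx1; simpa using hadd y hy
  -- If the shortest element were `x * w` with `x ≠ 1`, a left descent of `x⁻¹` in `I` would, by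
  -- additivity, be a left descent of `w = x⁻¹ * (x * w)`.
  · exfalso
    obtain ⟨s, hs, hlt⟩ := h.exists_desc_parabolic hI (inv_mem hx) (by simpa using hx1)
    have h1 := hadd _ (inv_mem hx)
    have h2 := hadd _ (mul_mem (Subgroup.subset_closure hs) (inv_mem hx))
    rw [inv_mul_cancel_left] at h1
    rw [mul_assoc, inv_mul_cancel_left] at h2
    have := hw s hs
    omega

/-- If all elements of `I` are left descents of `w`, then the elements of `⟨I⟩` are prefixes of
`w`. -/
theorem length_mul_of_all_desc (h : IsFoldingLength S (ℓ S)) (hI : I ⊆ S) {w : W}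
    (hw : ∀ s ∈ I, ℓ S (s * w) < ℓ S w) {y : W} (hy : y ∈ Subgroup.closure I) :
    ℓ S (y * w) + ℓ S y = ℓ S w := by
  suffices key : ∀ y ∈ Subgroup.closure I, ℓ S (y⁻¹ * w) + ℓ S y = ℓ S w by
    simpa [h.inv] using key _ (inv_mem hy)
  intro y hy
  induction hn : ℓ S y using Nat.strong_induction_on generalizing y with
  | _ n ih =>
    by_cases hy1 : y = 1
    · subst hy1; simp [← hn, wordLength_one]
    · obtain ⟨s, hs, hlt⟩ := h.exists_desc_parabolic hI hy hy1
      have hsy := mul_mem (Subgroup.subset_closure hs) hy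
      have h1 := ih _ (hn ▸ hlt) (s * y) hsy rfl
      have h2 := h.wordLength_step (hI hs) y
      obtain ⟨l, hl, hp, hl'⟩ := h.exists_reduced ((s * y)⁻¹ * w)
      have hp' : s * y * l.prod = w := by rw [hp, mul_inv_cancel_left]
      obtain ⟨l₁, t, l₂, rfl, heq⟩ := h.exchange (hI hs) l hl (s * y)
        (by rw [h.cancel (hI hs)]; omega) (by rw [hp']; exact hw s hs)
      have h4 := h.mul_prod_of_exchange (hl t (by simp)) (s * y) l₁ l₂ heq
      rw [hp'] at h4
      have h5 := wordLength_le (S := S) (l := l₁ ++ l₂)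
        (fun s hs => hl s (by simp at hs ⊢; tauto))
      have h6 : y⁻¹ * w = (l₁ ++ l₂).prod := by
        rw [inv_mul_eq_iff_eq_mul, ← h.cancel (hI hs) w, h4, ← mul_assoc, ← mul_assoc, h.sq s (hI hs),
          one_mul]
      have h7 := h.length_mul_le y (y⁻¹ * w)
      rw [mul_inv_cancel_left] at h7
      rw [h6] at h7 ⊢
      simp only [List.length_append, List.length_cons] at hl' h5
      omega

theorem finite_of_all_desc (h : IsFoldingLength S (ℓ S)) (hS : S.Finite) (hI : I ⊆ S) {w : W}
    (hw : ∀ s ∈ I, ℓ S (s * w) < ℓ S w) : (Subgroup.closure I : Set W).Finite :=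
  (h.finite_length_le hS (ℓ S w)).subset fun y hy => by
    have := h.length_mul_of_all_desc hI hw hy
    change ℓ S y ≤ ℓ S w
    omega

/-- `x` is a longest element of the group generated by `I`. -/
def _root_.IsLongestElement (S I : Set W) (x : W) : Prop :=
  x ∈ Subgroup.closure I ∧ ∀ y ∈ Subgroup.closure I, ℓ S y ≤ ℓ S x

theorem desc_of_longest (h : IsFoldingLength S (ℓ S)) (hI : I ⊆ S) {x : W}
    (hx : IsLongestElement S I x) {s : W} (hs : s ∈ I) : ℓ S (s * x) < ℓ S x := by
  have := hx.2 _ (mul_mem (Subgroup.subset_closure hs) hx.1)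
  have := h.wordLength_step (hI hs) x
  omega

theorem longest_of_all_desc (h : IsFoldingLength S (ℓ S)) (hI : I ⊆ S) {x : W}
    (hx : x ∈ Subgroup.closure I) (hd : ∀ s ∈ I, ℓ S (s * x) < ℓ S x) :
    IsLongestElement S I x :=
  ⟨hx, fun y hy => by have := h.length_mul_of_all_desc hI hd hy; omega⟩

theorem longest_unique (h : IsFoldingLength S (ℓ S)) (hI : I ⊆ S) {x y : W}
    (hx : IsLongestElement S I x) (hy : IsLongestElement S I y) : x = y := by
  have h1 := h.length_mul_of_all_desc hI (fun s hs => h.desc_of_longest hI hx hs) (inv_mem hy.1)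
  have h2 := hx.2 _ hy.1
  have h3 := hy.2 _ hx.1
  rw [h.inv] at h1
  have := h.length_eq_zero (w := y⁻¹ * x) (by omega)
  exact (inv_mul_eq_one.1 this).symm

theorem longest_inv (h : IsFoldingLength S (ℓ S)) {x : W} (hx : IsLongestElement S I x) :
    IsLongestElement S I x⁻¹ :=
  ⟨inv_mem hx.1, fun y hy => by rw [h.inv]; exact hx.2 y hy⟩

theorem longest_mul_self (h : IsFoldingLength S (ℓ S)) (hI : I ⊆ S) {x : W}
    (hx : IsLongestElement S I x) : x * x = 1 := by
  nth_rw 1 [h.longest_unique hI hx (h.longest_inv hx)]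
  exact inv_mul_cancel x

end IsFoldingLength

/-! ## The group of fixed points -/

namespace IsFoldingLength

variable {W : Type*} [Group W] {S : Set W} {G : Type*} [Group G] [MulDistribMulAction G W]

local notation "ℓ" => _root_.wordLength

theorem orbit_desc (hℓ : ∀ (g : G) (w : W), ℓ S (g • w) = ℓ S w)
    {s w : W} (hw : ∀ g : G, g • w = w) (hlt : ℓ S (s * w) < ℓ S w) :
    ∀ t ∈ MulAction.orbit G s, ℓ S (t * w) < ℓ S w := by
  rintro _ ⟨g, rfl⟩
  have := hℓ g (s * w)
  rw [smul_mul', hw] at this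
  simpa [this] using hlt

theorem orbit_subset (hGS : ∀ (g : G), ∀ s ∈ S, g • s ∈ S) {s : W} (hs : s ∈ S) :
    MulAction.orbit G s ⊆ S := by
  rintro _ ⟨g, rfl⟩
  exact hGS g s hs

theorem orbit_no_desc (h : IsFoldingLength S (ℓ S)) (hGS : ∀ (g : G), ∀ s ∈ S, g • s ∈ S)
    (hℓ : ∀ (g : G) (w : W), ℓ S (g • w) = ℓ S w)
    {s w : W} (hs : s ∈ S) (hw : ∀ g : G, g • w = w) (hlt : ¬ ℓ S (s * w) < ℓ S w) :
    ∀ t ∈ MulAction.orbit G s, ℓ S w < ℓ S (t * w) := by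
  rintro t ht
  rcases h.lt_or_lt (orbit_subset hGS hs ht) w with h1 | h1
  · exact h1
  · exact (hlt (orbit_desc hℓ hw h1 s (MulAction.mem_orbit_symm.1 ht))).elim

theorem longest_step (h : IsFoldingLength S (ℓ S)) (hGS : ∀ (g : G), ∀ s ∈ S, g • s ∈ S)
    (hℓ : ∀ (g : G) (w : W), ℓ S (g • w) = ℓ S w) {s x w : W} (hs : s ∈ S)
    (hx : IsLongestElement S (MulAction.orbit G s) x) (hw : ∀ g : G, g • w = w) :
    (ℓ S (s * w) < ℓ S w ∧ ℓ S (x * w) + ℓ S x = ℓ S w) ∨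
      (ℓ S w < ℓ S (s * w) ∧ ℓ S (x * w) = ℓ S w + ℓ S x) := by
  by_cases hd : ℓ S (s * w) < ℓ S w
  · exact Or.inl ⟨hd, h.length_mul_of_all_desc (orbit_subset hGS hs) (orbit_desc hℓ hw hd) hx.1⟩
  · have hd' := h.orbit_no_desc hGS hℓ hs hw hd
    refine Or.inr ⟨hd' s (MulAction.mem_orbit_self s), ?_⟩
    rw [h.length_mul_of_no_desc (orbit_subset hGS hs) hd' hx.1, add_comm]

theorem longest_fixed (h : IsFoldingLength S (ℓ S)) (hGS : ∀ (g : G), ∀ s ∈ S, g • s ∈ S)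
    (hℓ : ∀ (g : G) (w : W), ℓ S (g • w) = ℓ S w) {s x : W} (hs : s ∈ S)
    (hx : IsLongestElement S (MulAction.orbit G s) x) (g : G) : g • x = x := by
  refine h.longest_unique (orbit_subset hGS hs) ⟨?_, fun y hy => by rw [hℓ]; exact hx.2 y hy⟩ hx
  have : Subgroup.closure (MulAction.orbit G s) ≤
      (Subgroup.closure (MulAction.orbit G s)).comap (MulDistribMulAction.toMonoidHom W g) := by
    rw [Subgroup.closure_le]
    intro t ht
    exact Subgroup.subset_closure (MulAction.mem_orbit_of_mem_orbit g ht)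
  exact this hx.1

/-- An element of a parabolic subgroup attached to an orbit, fixed by `G`, is trivial or longest. -/
theorem eq_one_or_longest (h : IsFoldingLength S (ℓ S)) (hGS : ∀ (g : G), ∀ s ∈ S, g • s ∈ S)
    (hℓ : ∀ (g : G) (w : W), ℓ S (g • w) = ℓ S w) {s w : W} (hs : s ∈ S)
    (hw : ∀ g : G, g • w = w) (hmem : w ∈ Subgroup.closure (MulAction.orbit G s)) :
    w = 1 ∨ IsLongestElement S (MulAction.orbit G s) w := by
  by_cases hw1 : w = 1
  · exact Or.inl hw1
  · obtain ⟨t, ht, hlt⟩ := h.exists_desc_parabolic (orbit_subset hGS hs) hmem hw1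
    have := orbit_desc hℓ hw hlt
    rw [MulAction.orbit_eq_iff.2 ht] at this
    exact Or.inr (h.longest_of_all_desc (orbit_subset hGS hs) hmem this)

theorem conj_mem_closure {I J : Set W} {u : W} (hu : ∀ s ∈ I, u⁻¹ * s * u ∈ J) {x : W}
    (hx : x ∈ Subgroup.closure I) : u⁻¹ * x * u ∈ Subgroup.closure J := by
  have : Subgroup.closure I ≤ (Subgroup.closure J).comap (MulAut.conj u⁻¹).toMonoidHom := by
    rw [Subgroup.closure_le]
    intro s hs
    have := Subgroup.subset_closure (hu s hs)
    simpa using this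
  simpa using this hx

theorem length_conj (h : IsFoldingLength S (ℓ S)) {I J : Set W} (hI : I ⊆ S) (hJ : J ⊆ S) {u x : W}
    (h1 : ∀ s ∈ I, ℓ S u < ℓ S (s * u)) (h2 : ∀ s ∈ J, ℓ S u < ℓ S (u * s))
    (hx : x ∈ Subgroup.closure I) (hx' : u⁻¹ * x * u ∈ Subgroup.closure J) :
    ℓ S (u⁻¹ * x * u) = ℓ S x := by
  have e1 := h.length_mul_of_no_desc hI h1 hx
  have e2 := h.length_mul_of_no_desc hJ (w := u⁻¹)
    (fun s hs => by rw [← h.length_mul_right (hJ hs), h.inv]; exact h2 s hs) (inv_mem hx')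
  have e3 : (u⁻¹ * x * u)⁻¹ * u⁻¹ = (x * u)⁻¹ := by group
  rw [e3, h.inv, h.inv, h.inv] at e2
  omega

theorem longest_fold (h : IsFoldingLength S (ℓ S)) (hGS : ∀ (g : G), ∀ s ∈ S, g • s ∈ S)
    (hℓ : ∀ (g : G) (w : W), ℓ S (g • w) = ℓ S w) {s t x y u : W} (hs : s ∈ S) (ht : t ∈ S)
    (hx : IsLongestElement S (MulAction.orbit G s) x)
    (hy : IsLongestElement S (MulAction.orbit G t) y)
    (hu : ∀ g : G, g • u = u) (h1 : ℓ S u < ℓ S (x * u)) (h2 : ℓ S (x * (u * y)) < ℓ S (u * y)) :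
    x * u = u * y := by
  have hI := orbit_subset hGS hs
  have hJ := orbit_subset hGS ht
  have hyG := h.longest_fixed hGS hℓ ht hy
  have huy : ∀ g : G, g • (u * y) = u * y := fun g => by rw [smul_mul', hu, hyG]
  have huI : ∀ s' ∈ MulAction.orbit G s, ℓ S u < ℓ S (s' * u) := by
    refine h.orbit_no_desc hGS hℓ hs hu fun hlt => ?_
    have := h.length_mul_of_all_desc hI (orbit_desc hℓ hu hlt) hx.1
    omega
  have huyI : ∀ s' ∈ MulAction.orbit G s, ℓ S (s' * (u * y)) < ℓ S (u * y) := by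
    refine orbit_desc hℓ huy ?_
    rcases h.longest_step hGS hℓ hs hx huy with h3 | h3
    · exact h3.1
    · omega
  have huinv : ∀ g : G, g • u⁻¹ = u⁻¹ := fun g => by rw [smul_inv', hu]
  have hyinv : y⁻¹ = y := inv_eq_of_mul_eq_one_right (h.longest_mul_self hJ hy)
  have hyu : ℓ S (y * u⁻¹) = ℓ S (u * y) := by rw [← h.inv, mul_inv_rev, inv_inv, hyinv]
  rcases h.longest_step hGS hℓ ht hy huinv with h3 | h3
  · exfalso
    have h4 := huyI s (MulAction.mem_orbit_self s)
    have h5 := huI s (MulAction.mem_orbit_self s)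
    have h6 := h.length_mul_le (s * (u * y)) y
    have h7 : s * (u * y) * y = s * u := by
      rw [mul_assoc, mul_assoc, h.longest_mul_self hJ hy, mul_one]
    have h8 := h3.2
    rw [hyu, h.inv] at h8
    rw [h7] at h6
    omega
  · have huJ : ∀ t' ∈ MulAction.orbit G t, ℓ S u < ℓ S (u * t') := by
      intro t' ht'
      have := h.orbit_no_desc hGS hℓ ht huinv (not_lt.2 h3.1.le) t' ht'
      rwa [← h.length_mul_right (hJ ht'), h.inv] at this
    have hconj : ∀ s' ∈ MulAction.orbit G s, u⁻¹ * s' * u ∈ MulAction.orbit G t := by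
      intro s' hs'
      obtain ⟨l, hl, hp, hl'⟩ := h.exists_reduced_parabolic hJ hy.1
      obtain ⟨l₁, t', l₂, rfl, heq⟩ := h.exchange (hI hs') l (fun x hx => hJ (hl x hx)) u
        (huI s' hs') (by rw [hp]; exact huyI s' hs')
      have hl₁ : l₁.prod ∈ Subgroup.closure (MulAction.orbit G t) :=
        list_prod_mem fun z hz => Subgroup.subset_closure (hl z (by simp [hz]))
      have e : u⁻¹ * s' * u = l₁.prod * t' * l₁.prod⁻¹ := by
        rw [eq_mul_inv_iff_mul_eq, mul_assoc, mul_assoc, inv_mul_eq_iff_eq_mul, heq, mul_assoc]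
      have hz : u⁻¹ * s' * u ∈ Subgroup.closure (MulAction.orbit G t) := by
        rw [e]
        exact mul_mem (mul_mem hl₁ (Subgroup.subset_closure (hl t' (by simp)))) (inv_mem hl₁)
      refine h.mem_of_length_one hJ hz ?_
      rw [h.length_conj hI hJ huI huJ (Subgroup.subset_closure hs') hz,
        h.wordLength_simple (hI hs')]
    have hconj' : ∀ t' ∈ MulAction.orbit G t, u⁻¹⁻¹ * t' * u⁻¹ ∈ MulAction.orbit G s := by
      have h4 := hconj s (MulAction.mem_orbit_self s)
      rw [← MulAction.orbit_eq_iff.2 h4]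
      rintro _ ⟨g, rfl⟩
      refine ⟨g, ?_⟩
      simp only [smul_mul', hu, huinv]
      group
    have hy' : IsLongestElement S (MulAction.orbit G t) (u⁻¹ * x * u) := by
      refine ⟨conj_mem_closure hconj hx.1, fun z hz => ?_⟩
      rw [h.length_conj hI hJ huI huJ hx.1 (conj_mem_closure hconj hx.1)]
      have hz' := conj_mem_closure hconj' hz
      have e : u⁻¹ * (u⁻¹⁻¹ * z * u⁻¹) * u = z := by group
      have := h.length_conj hI hJ huI huJ hz' (by rwa [e])
      rw [e] at this
      rw [this]
      exact hx.2 _ hz'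
    rw [← h.longest_unique hJ hy' hy]
    group

/-- On the group of fixed points, the length is a length function with the folding property,
relative to the longest elements of the finite groups generated by orbits. -/
theorem fixedPoints (h : IsFoldingLength S (ℓ S)) (hS : S.Finite)
    (hGS : ∀ (g : G), ∀ s ∈ S, g • s ∈ S) (hℓ : ∀ (g : G) (w : W), ℓ S (g • w) = ℓ S w) :
    IsFoldingLength (fixedGenerators S G) (fun w => ℓ S (w : W)) where
  one := h.one
  inv w := h.inv w
  sq := by
    rintro x ⟨s, hs, -, hx⟩
    exact Subtype.ext (h.longest_mul_self (orbit_subset hGS hs) hx)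
  pos := by
    rintro x ⟨s, hs, -, hx⟩
    have := h.desc_of_longest (orbit_subset hGS hs) hx (MulAction.mem_orbit_self s)
    omega
  step := by
    rintro x ⟨s, hs, -, hx⟩ w
    exact ((h.longest_step hGS hℓ hs hx w.2).imp And.right And.right).symm
  desc := by
    intro w hw
    obtain ⟨s, hs, hlt⟩ := h.desc (w : W) (by simpa using hw)
    have hI := orbit_subset (G := G) hGS hs
    have hd := orbit_desc hℓ w.2 hlt
    have hfin := h.finite_of_all_desc hS hI hd
    obtain ⟨x, hx, hmax⟩ := Set.exists_max_image _ (ℓ S) hfin ⟨1, one_mem _⟩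
    have hx' : IsLongestElement S (MulAction.orbit G s) x := ⟨hx, hmax⟩
    refine ⟨⟨x, h.longest_fixed hGS hℓ hs hx'⟩, ⟨s, hs, hfin, hx'⟩, ?_⟩
    have h1 := h.length_mul_of_all_desc hI hd hx
    have h2 := h.desc_of_longest hI hx' (MulAction.mem_orbit_self s)
    change ℓ S (x * w) < _
    omega
  fold := by
    rintro x ⟨s, hs, -, hx⟩ y ⟨t, ht, -, hy⟩ w h1 h2
    exact Subtype.ext (h.longest_fold hGS hℓ hs ht hx hy w.2 h1 h2)

end IsFoldingLength

/-! ## The standard basis of the Hecke algebra -/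

section HeckeBasis

variable {W Γ : Type*} [Group W] [AddCommGroup Γ] {S : Set W} {φ : W → Γ}

local notation "ℓ" => wordLength

theorem expo_mul (γ δ : Γ) : expo γ * expo δ = expo (γ + δ) := by
  simp [AddMonoidAlgebra.single_mul_single]

theorem expo_zero : expo (0 : Γ) = 1 := rfl

theorem expo_mul_neg (γ : Γ) : expo γ * expo (-γ) = 1 := by
  rw [expo_mul, add_neg_cancel, expo_zero]

/-- The parameter `e^{φ(s)} - e^{-φ(s)}`. -/
noncomputable def heckeParam (φ : W → Γ) (s : W) : WeightRing Γ := expo (φ s) - expo (-φ s)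

theorem heckeT_one : heckeT S φ 1 = 1 := by
  simpa [heckeT] using RingQuot.mkAlgHom_rel (WeightRing Γ) (HeckeRel.one (S := S) (φ := φ))

theorem heckeT_mul {v w : W} (hvw : ℓ S (v * w) = ℓ S v + ℓ S w) :
    heckeT S φ v * heckeT S φ w = heckeT S φ (v * w) := by
  simpa [heckeT] using RingQuot.mkAlgHom_rel (WeightRing Γ) (HeckeRel.mul (φ := φ) v w hvw)

theorem heckeT_quad {s : W} (hs : s ∈ S) :
    (heckeT S φ s - algebraMap _ _ (expo (φ s))) * (heckeT S φ s + algebraMap _ _ (expo (-φ s)))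
      = 0 := by
  simpa only [heckeT, map_mul, map_sub, map_add, map_zero, AlgHom.commutes] using
    RingQuot.mkAlgHom_rel (WeightRing Γ) (HeckeRel.quad (φ := φ) s hs)

/-- The quadratic relation, solved for the square. -/
theorem sq_eq_of_quad {R A : Type*} [CommRing R] [Ring A] [Algebra R A] {q q' : R} (hq : q * q' = 1)
    (T : A) : (T - algebraMap R A q) * (T + algebraMap R A q') = 0 ↔ T * T = 1 + (q - q') • T := by
  have : (T - algebraMap R A q) * (T + algebraMap R A q') = T * T - (1 + (q - q') • T) := by
    rw [sub_mul, mul_add, mul_add, ← map_mul, hq, map_one, ← Algebra.commutes q', sub_smul,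
      ← Algebra.smul_def, ← Algebra.smul_def]
    abel
  rw [this, sub_eq_zero]

theorem heckeT_mul_self {s : W} (hs : s ∈ S) :
    heckeT S φ s * heckeT S φ s = 1 + heckeParam φ s • heckeT S φ s :=
  (sq_eq_of_quad (R := WeightRing Γ) (A := HeckeAlgebra S φ) (expo_mul_neg _) _).1 (heckeT_quad hs)

theorem heckeT_mul_of_lt (h : IsFoldingLength S (ℓ S)) {s w : W} (hs : s ∈ S)
    (hlt : ℓ S w < ℓ S (s * w)) : heckeT S φ s * heckeT S φ w = heckeT S φ (s * w) := by
  refine heckeT_mul ?_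
  have := h.wordLength_step hs w
  rw [h.wordLength_simple hs]
  omega

theorem heckeT_mul_of_gt (h : IsFoldingLength S (ℓ S)) {s w : W} (hs : s ∈ S)
    (hlt : ℓ S (s * w) < ℓ S w) :
    heckeT S φ s * heckeT S φ w = heckeT S φ (s * w) + heckeParam φ s • heckeT S φ w := by
  have e := heckeT_mul_of_lt (φ := φ) h hs (w := s * w) (by rwa [h.cancel hs])
  rw [h.cancel hs] at e
  rw [← e, ← mul_assoc, heckeT_mul_self hs, add_mul, one_mul, smul_mul_assoc]

open Finsupp

open Classical in
/-- Left multiplication by `T_s`, on the free module with basis `W`. -/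
noncomputable def leftOp (S : Set W) (φ : W → Γ) (s : W) : Module.End (WeightRing Γ) (W →₀ WeightRing Γ) :=
  linearCombination _ fun w =>
    single (s * w) 1 + (if ℓ S w < ℓ S (s * w) then 0 else heckeParam φ s) • single w 1

open Classical in
/-- Right multiplication by `T_s`, on the free module with basis `W`. -/
noncomputable def rightOp (S : Set W) (φ : W → Γ) (s : W) : Module.End (WeightRing Γ) (W →₀ WeightRing Γ) :=
  linearCombination _ fun w =>
    single (w * s) 1 + (if ℓ S w < ℓ S (w * s) then 0 else heckeParam φ s) • single w 1

open Classical in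
theorem leftOp_single (s w : W) : leftOp S φ s (single w 1) =
    single (s * w) 1 + (if ℓ S w < ℓ S (s * w) then 0 else heckeParam φ s) • single w 1 := by
  rw [leftOp, linearCombination_single, one_smul]

open Classical in
theorem rightOp_single (s w : W) : rightOp S φ s (single w 1) =
    single (w * s) 1 + (if ℓ S w < ℓ S (w * s) then 0 else heckeParam φ s) • single w 1 := by
  rw [rightOp, linearCombination_single, one_smul]

theorem weight_eq_of_fold (h : IsFoldingLength S (ℓ S)) (hφ : IsWeightFunction S φ) {s t w : W}
    (hs : s ∈ S) (ht : t ∈ S) (heq : s * w = w * t) : φ s = φ t := by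
  have key : ∀ w, ℓ S w < ℓ S (s * w) → s * w = w * t → φ s = φ t := by
    intro w hlt heq
    have h1 := h.wordLength_step hs w
    have e1 := hφ s w (by rw [h.wordLength_simple hs]; omega)
    have e2 := hφ w t (by rw [← heq, h.wordLength_simple ht]; omega)
    rw [heq, e2, add_comm] at e1
    exact (add_right_cancel e1).symm
  rcases h.lt_or_lt hs w with hlt | hlt
  · exact key w hlt heq
  · refine key (s * w) (by rwa [h.cancel hs]) ?_
    rw [h.cancel hs, heq, h.cancel_right ht]

theorem lt_iff_of_not_fold (h : IsFoldingLength S (ℓ S)) {s t w : W}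
    (hs : s ∈ S) (ht : t ∈ S) (hne : s * w ≠ w * t) :
    ℓ S w < ℓ S (s * w) ↔ ℓ S (w * t) < ℓ S (s * (w * t)) := by
  constructor
  · intro h1
    rcases h.lt_or_lt hs (w * t) with h2 | h2
    · exact h2
    · exact (hne (h.fold s hs t ht w h1 h2)).elim
  · intro h1
    rcases h.lt_or_lt hs w with h2 | h2
    · exact h2
    · have := h.fold s hs t ht (w * t) h1 (by rwa [h.cancel_right ht])
      rw [h.cancel_right ht] at this
      refine (hne ?_).elim
      nth_rw 1 [← this]
      rw [h.cancel hs]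

theorem lt_iff_of_not_fold_right (h : IsFoldingLength S (ℓ S)) {s t w : W}
    (hs : s ∈ S) (ht : t ∈ S) (hne : s * w ≠ w * t) :
    ℓ S w < ℓ S (w * t) ↔ ℓ S (s * w) < ℓ S (s * w * t) := by
  have := lt_iff_of_not_fold h (w := w⁻¹) ht hs (fun e => hne (by
    have e' := congrArg (·⁻¹) e
    simp only [mul_inv_rev, inv_inv, h.inv_eq hs, h.inv_eq ht] at e'
    exact e'.symm))
  rw [← h.length_mul_right ht, h.inv] at this
  rw [this, ← h.inv (s * w), ← h.inv (s * w * t)]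
  simp only [mul_inv_rev, h.inv_eq hs, h.inv_eq ht]

theorem leftOp_comm_rightOp (h : IsFoldingLength S (ℓ S)) (hφ : IsWeightFunction S φ) {s t : W}
    (hs : s ∈ S) (ht : t ∈ S) : Commute (leftOp S φ s) (rightOp S φ t) := by
  classical
  refine Finsupp.lhom_ext' fun w => LinearMap.ext_ring ?_
  simp only [Module.End.mul_apply, LinearMap.comp_apply, lsingle_apply, leftOp_single,
    rightOp_single, map_add, map_smul]
  by_cases heq : s * w = w * t
  · have e1 : s * (w * t) = w := by rw [← heq, h.cancel hs]
    have e2 : s * w * t = w := by rw [heq, h.cancel_right ht]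
    have e3 : heckeParam φ s = heckeParam φ t := by
      rw [heckeParam, heckeParam, weight_eq_of_fold h hφ hs ht heq]
    have e4 : w * t * t = w := h.cancel_right ht w
    simp only [e1, e3, e4, heq]
  · have e1 := lt_iff_of_not_fold h hs ht heq
    have e2 := lt_iff_of_not_fold_right h hs ht heq
    rw [← mul_assoc] at e1 ⊢
    simp only [← e1, ← e2, smul_add]
    rw [smul_comm (if ℓ S w < ℓ S (s * w) then 0 else heckeParam φ s)
      (if ℓ S w < ℓ S (w * t) then 0 else heckeParam φ t)]
    exact add_add_add_comm _ _ _ _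

/-- An endomorphism which commutes with all right multiplications is determined by its value at
the neutral element. -/
theorem eq_of_comm_rightOp (h : IsFoldingLength S (ℓ S))
    {X Y : Module.End (WeightRing Γ) (W →₀ WeightRing Γ)}
    (hX : ∀ t ∈ S, Commute X (rightOp S φ t)) (hY : ∀ t ∈ S, Commute Y (rightOp S φ t))
    (hXY : X (single 1 1) = Y (single 1 1)) : X = Y := by
  classical
  suffices key : ∀ w, X (single w 1) = Y (single w 1) from
    Finsupp.lhom_ext' fun w => LinearMap.ext_ring (key w)
  intro w
  induction hn : ℓ S w using Nat.strong_induction_on generalizing w with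
  | _ n ih =>
    by_cases hw : w = 1
    · rw [hw, hXY]
    · obtain ⟨t, ht, hlt⟩ := h.desc_right hw
      have e : rightOp S φ t (single (w * t) 1) = single w 1 := by
        rw [rightOp_single, h.cancel_right ht, if_pos hlt, zero_smul, add_zero]
      have eX := LinearMap.congr_fun (hX t ht) (single (w * t) 1)
      have eY := LinearMap.congr_fun (hY t ht) (single (w * t) 1)
      rw [Module.End.mul_apply, Module.End.mul_apply, e] at eX eY
      rw [eX, eY, ih _ (hn ▸ hlt) (w * t) rfl]

theorem exists_comm_rightOp (h : IsFoldingLength S (ℓ S)) (hφ : IsWeightFunction S φ) (w : W) :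
    ∃ X : Module.End (WeightRing Γ) (W →₀ WeightRing Γ),
      (∀ t ∈ S, Commute X (rightOp S φ t)) ∧ X (single 1 1) = single w 1 := by
  classical
  induction hn : ℓ S w using Nat.strong_induction_on generalizing w with
  | _ n ih =>
    by_cases hw : w = 1
    · exact ⟨1, fun t _ => Commute.one_left _, by rw [hw]; rfl⟩
    · obtain ⟨s, hs, hlt⟩ := h.desc w hw
      obtain ⟨X, hX, hX'⟩ := ih _ (hn ▸ hlt) (s * w) rfl
      refine ⟨leftOp S φ s * X, fun t ht => (leftOp_comm_rightOp h hφ hs ht).mul_left (hX t ht), ?_⟩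
      rw [Module.End.mul_apply, hX', leftOp_single, h.cancel hs, if_pos hlt, zero_smul, add_zero]

/-- The endomorphism by which `T_w` acts on the regular representation. -/
noncomputable def regularOp (h : IsFoldingLength S (ℓ S)) (hφ : IsWeightFunction S φ) (w : W) :
    Module.End (WeightRing Γ) (W →₀ WeightRing Γ) :=
  (exists_comm_rightOp h hφ w).choose

theorem regularOp_comm (h : IsFoldingLength S (ℓ S)) (hφ : IsWeightFunction S φ) (w : W) :
    ∀ t ∈ S, Commute (regularOp h hφ w) (rightOp S φ t) :=
  (exists_comm_rightOp h hφ w).choose_spec.1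

theorem regularOp_one_apply (h : IsFoldingLength S (ℓ S)) (hφ : IsWeightFunction S φ) (w : W) :
    regularOp h hφ w (single 1 1) = single w 1 :=
  (exists_comm_rightOp h hφ w).choose_spec.2

theorem regularOp_simple (h : IsFoldingLength S (ℓ S)) (hφ : IsWeightFunction S φ) {s : W}
    (hs : s ∈ S) : regularOp h hφ s = leftOp S φ s := by
  classical
  refine eq_of_comm_rightOp h (regularOp_comm h hφ s)
    (fun t ht => leftOp_comm_rightOp h hφ hs ht) ?_
  rw [regularOp_one_apply, leftOp_single, mul_one, if_pos, zero_smul, add_zero]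
  rw [h.one]
  exact h.pos s hs

theorem regularOp_mul_simple (h : IsFoldingLength S (ℓ S)) (hφ : IsWeightFunction S φ) {s w : W}
    (hs : s ∈ S) (hlt : ℓ S (s * w) < ℓ S w) :
    regularOp h hφ w = leftOp S φ s * regularOp h hφ (s * w) := by
  classical
  refine eq_of_comm_rightOp h (regularOp_comm h hφ w)
    (fun t ht => (leftOp_comm_rightOp h hφ hs ht).mul_left (regularOp_comm h hφ _ t ht)) ?_
  rw [Module.End.mul_apply, regularOp_one_apply, regularOp_one_apply, leftOp_single, h.cancel hs,
    if_pos hlt, zero_smul, add_zero]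

theorem regularOp_mul (h : IsFoldingLength S (ℓ S)) (hφ : IsWeightFunction S φ) (v w : W)
    (hvw : ℓ S (v * w) = ℓ S v + ℓ S w) :
    regularOp h hφ v * regularOp h hφ w = regularOp h hφ (v * w) := by
  classical
  refine eq_of_comm_rightOp h
    (fun t ht => (regularOp_comm h hφ v t ht).mul_left (regularOp_comm h hφ w t ht))
    (regularOp_comm h hφ _) ?_
  rw [Module.End.mul_apply, regularOp_one_apply, regularOp_one_apply]
  induction hn : ℓ S v using Nat.strong_induction_on generalizing v with
  | _ n ih =>
    by_cases hv : v = 1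
    · subst hv
      have : regularOp h hφ (1 : W) = 1 :=
        eq_of_comm_rightOp h (regularOp_comm h hφ 1) (fun t _ => Commute.one_left _)
          (by rw [regularOp_one_apply]; rfl)
      rw [this, one_mul]
      rfl
    · obtain ⟨s, hs, hlt⟩ := h.desc v hv
      obtain ⟨h1, h2⟩ := h.additive_peel hs hlt hvw
      rw [regularOp_mul_simple h hφ hs hlt, Module.End.mul_apply, ih _ (hn ▸ hlt) _ h1 rfl,
        leftOp_single, ← mul_assoc, ← mul_assoc, h.sq s hs, one_mul, if_pos h2, zero_smul, add_zero]

/-- The regular representation of the Hecke algebra. -/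
noncomputable def regularRep (h : IsFoldingLength S (ℓ S)) (hφ : IsWeightFunction S φ) :
    HeckeAlgebra S φ →ₐ[WeightRing Γ] Module.End (WeightRing Γ) (W →₀ WeightRing Γ) :=
  RingQuot.liftAlgHom (WeightRing Γ) ⟨FreeAlgebra.lift (WeightRing Γ) (regularOp h hφ), by
    classical
    intro x y hxy
    induction hxy with
    | one =>
      rw [FreeAlgebra.lift_ι_apply, map_one]
      exact eq_of_comm_rightOp h (regularOp_comm h hφ 1) (fun t _ => Commute.one_left _)
        (by rw [regularOp_one_apply]; rfl)
    | mul w w' hw =>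
      rw [map_mul, FreeAlgebra.lift_ι_apply, FreeAlgebra.lift_ι_apply, FreeAlgebra.lift_ι_apply]
      exact regularOp_mul h hφ w w' hw
    | quad s hs =>
      simp only [map_mul, map_sub, map_add, map_zero, FreeAlgebra.lift_ι_apply, AlgHom.commutes]
      rw [sq_eq_of_quad (R := WeightRing Γ) (A := Module.End (WeightRing Γ) (W →₀ WeightRing Γ))
        (expo_mul_neg _)]
      have hc := regularOp_comm h hφ s
      refine eq_of_comm_rightOp h (fun t ht => (hc t ht).mul_left (hc t ht))
        (fun t ht => (Commute.one_left _).add_left ((hc t ht).smul_left _)) ?_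
      rw [Module.End.mul_apply, regularOp_one_apply, LinearMap.add_apply, LinearMap.smul_apply,
        regularOp_one_apply, regularOp_simple h hφ hs, leftOp_single, h.sq s hs, if_neg]
      · rfl
      · rw [h.one]
        omega⟩

theorem regularRep_heckeT (h : IsFoldingLength S (ℓ S)) (hφ : IsWeightFunction S φ) (w : W) :
    regularRep h hφ (heckeT S φ w) = regularOp h hφ w := by
  simp [regularRep, heckeT]

/-- The coordinates of an element of the Hecke algebra. -/
noncomputable def heckeCoord (h : IsFoldingLength S (ℓ S)) (hφ : IsWeightFunction S φ) :
    HeckeAlgebra S φ →ₗ[WeightRing Γ] (W →₀ WeightRing Γ) :=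
  (LinearMap.applyₗ (single 1 1)).comp (regularRep h hφ).toLinearMap

theorem heckeCoord_heckeT (h : IsFoldingLength S (ℓ S)) (hφ : IsWeightFunction S φ) (w : W) :
    heckeCoord h hφ (heckeT S φ w) = single w 1 := by
  rw [heckeCoord, LinearMap.comp_apply, AlgHom.toLinearMap_apply, regularRep_heckeT]
  exact regularOp_one_apply h hφ w

/-- A submodule stable under left multiplication by the `T_s` is stable under the `T_w`. -/
theorem heckeT_mul_mem (h : IsFoldingLength S (ℓ S))
    {N : Submodule (WeightRing Γ) (HeckeAlgebra S φ)}
    {I : Set W} (hI : I ⊆ S) (hN : ∀ s ∈ I, ∀ x ∈ N, heckeT S φ s * x ∈ N) {w : W}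
    (hw : w ∈ Subgroup.closure I) {x : HeckeAlgebra S φ} (hx : x ∈ N) : heckeT S φ w * x ∈ N := by
  induction hn : ℓ S w using Nat.strong_induction_on generalizing w with
  | _ n ih =>
    by_cases hw1 : w = 1
    · rwa [hw1, heckeT_one, one_mul]
    · obtain ⟨s, hs, hlt⟩ := h.exists_desc_parabolic hI hw hw1
      have e := heckeT_mul_of_lt (φ := φ) h (hI hs) (w := s * w) (by rwa [h.cancel (hI hs)])
      rw [h.cancel (hI hs)] at e
      rw [← e, mul_assoc]
      exact hN s hs _ (ih _ (hn ▸ hlt) (mul_mem (Subgroup.subset_closure hs) hw) rfl)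

theorem span_heckeT_mul_mem (h : IsFoldingLength S (ℓ S)) {U V : Set W}
    {s : W} (hs : s ∈ S) (hU : ∀ w ∈ U, s * w ∈ V) (hUV : U ⊆ V) {x : HeckeAlgebra S φ}
    (hx : x ∈ Submodule.span (WeightRing Γ) (heckeT S φ '' U)) :
    heckeT S φ s * x ∈ Submodule.span (WeightRing Γ) (heckeT S φ '' V) := by
  induction hx using Submodule.span_induction with
  | mem x hx =>
    obtain ⟨w, hw, rfl⟩ := hx
    have h1 := Submodule.subset_span (R := WeightRing Γ)
      (Set.mem_image_of_mem (heckeT S φ) (hU w hw))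
    rcases h.lt_or_lt hs w with hlt | hlt
    · rwa [heckeT_mul_of_lt h hs hlt]
    · rw [heckeT_mul_of_gt h hs hlt]
      exact add_mem h1 (Submodule.smul_mem _ _ (Submodule.subset_span ⟨w, hUV hw, rfl⟩))
  | zero => rw [mul_zero]; exact zero_mem _
  | add x y _ _ hx hy => rw [mul_add]; exact add_mem hx hy
  | smul r x _ hx => rw [mul_smul_comm]; exact Submodule.smul_mem _ r hx

theorem closure_eq_top (h : IsFoldingLength S (ℓ S)) : Subgroup.closure S = ⊤ := by
  refine eq_top_iff.2 fun w _ => ?_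
  obtain ⟨l, hl, rfl⟩ := h.exists_word w
  exact list_prod_mem fun s hs => Subgroup.subset_closure (hl s hs)

theorem span_heckeT (h : IsFoldingLength S (ℓ S)) :
    Submodule.span (WeightRing Γ) (Set.range (heckeT S φ)) = ⊤ := by
  have key : ∀ x : FreeAlgebra (WeightRing Γ) W,
      ∀ y ∈ Submodule.span (WeightRing Γ) (Set.range (heckeT S φ)),
      RingQuot.mkAlgHom (WeightRing Γ) (HeckeRel S φ) x * y ∈
        Submodule.span (WeightRing Γ) (Set.range (heckeT S φ)) := by
    intro x
    induction x using FreeAlgebra.induction with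
    | grade0 r =>
      intro y hy
      rw [AlgHom.commutes, ← Algebra.smul_def]
      exact Submodule.smul_mem _ _ hy
    | grade1 w =>
      intro y hy
      refine heckeT_mul_mem h subset_rfl (fun s hs x hx => ?_) (w := w)
        (by rw [closure_eq_top h]; trivial) hy
      rw [← Set.image_univ] at hx ⊢
      exact span_heckeT_mul_mem h hs (U := Set.univ) (V := Set.univ) (fun _ _ => trivial) subset_rfl hx
    | mul a b ha hb => intro y hy; rw [map_mul, mul_assoc]; exact ha _ (hb _ hy)
    | add a b ha hb => intro y hy; rw [map_add, add_mul]; exact add_mem (ha _ hy) (hb _ hy)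
  refine eq_top_iff.2 fun x _ => ?_
  obtain ⟨x, rfl⟩ := RingQuot.mkAlgHom_surjective (WeightRing Γ) (HeckeRel S φ) x
  simpa using key x 1 (by rw [← heckeT_one]; exact Submodule.subset_span ⟨1, rfl⟩)

/-- The standard basis of the Hecke algebra. -/
noncomputable def heckeBasis (h : IsFoldingLength S (ℓ S)) (hφ : IsWeightFunction S φ) :
    Module.Basis W (WeightRing Γ) (HeckeAlgebra S φ) :=
  Module.Basis.mk (v := heckeT S φ)
    (LinearIndependent.of_comp (heckeCoord h hφ) (by
      have : (heckeCoord h hφ) ∘ heckeT S φ = fun w => single w 1 :=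
        funext fun w => heckeCoord_heckeT h hφ w
      rw [this]
      exact Finsupp.linearIndependent_single_one _ _))
    (span_heckeT h).ge

@[simp]
theorem heckeBasis_apply (h : IsFoldingLength S (ℓ S)) (hφ : IsWeightFunction S φ) (w : W) :
    heckeBasis h hφ w = heckeT S φ w :=
  Module.Basis.mk_apply _ _ _

@[simp]
theorem heckeBasis_repr_heckeT (h : IsFoldingLength S (ℓ S)) (hφ : IsWeightFunction S φ) (w : W) :
    (heckeBasis h hφ).repr (heckeT S φ w) = single w 1 := by
  rw [← heckeBasis_apply h hφ, Module.Basis.repr_self]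

end HeckeBasis

/-! ## The bar involution -/

section BarInvolution

variable {W Γ : Type*} [Group W] [AddCommGroup Γ] {S : Set W} {φ : W → Γ}

local notation "ℓ" => wordLength

/-- The involution `e^γ ↦ e^{-γ}` of `ℤ[Γ]`. -/
noncomputable def weightBar (Γ : Type*) [AddCommGroup Γ] : WeightRing Γ →+* WeightRing Γ :=
  (AddMonoidAlgebra.domCongr ℤ ℤ (AddEquiv.neg Γ)).toAlgHom.toRingHom

theorem weightBar_expo (γ : Γ) : weightBar Γ (expo γ) = expo (-γ) :=
  AddMonoidAlgebra.domCongr_single _ _ _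

theorem coeff_weightBar (a : WeightRing Γ) (γ : Γ) : (weightBar Γ a).coeff γ = a.coeff (-γ) :=
  AddMonoidAlgebra.coeff_domCongr _ _ _

theorem weight_ringHom_ext {R : Type*} [Semiring R] {f g : WeightRing Γ →+* R}
    (h : ∀ γ, f (expo γ) = g (expo γ)) : f = g :=
  AddMonoidAlgebra.ringHom_ext
    (RingHom.congr_fun (RingHom.ext_int (f.comp AddMonoidAlgebra.singleZeroRingHom)
      (g.comp AddMonoidAlgebra.singleZeroRingHom))) h

theorem natCast_dvd_iff (n : ℕ) (a : WeightRing Γ) :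
    (n : WeightRing Γ) ∣ a ↔ ∀ γ, (n : ℤ) ∣ a.coeff γ := by
  constructor
  · rintro ⟨c, rfl⟩ γ
    rw [AddMonoidAlgebra.natCast_def, AddMonoidAlgebra.coeff_single_zero_mul]
    exact Dvd.intro _ rfl
  · intro h
    refine ⟨.ofCoeff (a.coeff.mapRange (· / (n : ℤ)) (Int.zero_ediv _)), ?_⟩
    ext γ
    rw [AddMonoidAlgebra.natCast_def, AddMonoidAlgebra.coeff_single_zero_mul]
    exact (Int.mul_ediv_cancel' (h γ)).symm

theorem exists_nsmul_iff_dvd_repr {R M ι : Type*} [CommRing R] [AddCommGroup M] [Module R M]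
    (b : Module.Basis ι R M) (n : ℕ) (m : M) :
    (∃ m', m = n • m') ↔ ∀ i, (n : R) ∣ b.repr m i := by
  constructor
  · rintro ⟨m', rfl⟩ i
    rw [map_nsmul, Finsupp.smul_apply, nsmul_eq_mul]
    exact Dvd.intro _ rfl
  · intro h
    choose c hc using h
    classical
    refine ⟨∑ i ∈ (b.repr m).support, c i • b i, ?_⟩
    rw [Finset.smul_sum]
    conv_lhs => rw [← b.linearCombination_repr m, Finsupp.linearCombination_apply, Finsupp.sum]
    refine Finset.sum_congr rfl fun i _ => ?_
    rw [hc, mul_smul, Nat.cast_smul_eq_nsmul]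

theorem hecke_ringHom_ext {B : Type*} [Semiring B] {f g : HeckeAlgebra S φ →+* B}
    (hA : ∀ γ, f (algebraMap (WeightRing Γ) _ (expo γ)) = g (algebraMap (WeightRing Γ) _ (expo γ)))
    (hT : ∀ w, f (heckeT S φ w) = g (heckeT S φ w)) : f = g := by
  have hA' : f.comp (algebraMap (WeightRing Γ) _) = g.comp (algebraMap (WeightRing Γ) _) :=
    weight_ringHom_ext hA
  refine RingHom.ext fun x => ?_
  obtain ⟨x, rfl⟩ := RingQuot.mkAlgHom_surjective (WeightRing Γ) (HeckeRel S φ) x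
  induction x using FreeAlgebra.induction with
  | grade0 r => rw [AlgHom.commutes]; exact RingHom.congr_fun hA' r
  | grade1 w => exact hT w
  | mul a b ha hb => rw [map_mul, map_mul, map_mul, ha, hb]
  | add a b ha hb => rw [map_add, map_add, map_add, ha, hb]

theorem heckeT_simple_mul_inv {s : W} (hs : s ∈ S) :
    heckeT S φ s * (heckeT S φ s - algebraMap _ _ (heckeParam φ s)) = 1 := by
  rw [mul_sub (heckeT S φ s), heckeT_mul_self hs, ← Algebra.commutes, ← Algebra.smul_def,
    add_sub_cancel_right (G := HeckeAlgebra S φ)]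

theorem heckeT_simple_inv_mul {s : W} (hs : s ∈ S) :
    (heckeT S φ s - algebraMap _ _ (heckeParam φ s)) * heckeT S φ s = 1 := by
  rw [sub_mul (heckeT S φ s), heckeT_mul_self hs, ← Algebra.smul_def,
    add_sub_cancel_right (G := HeckeAlgebra S φ)]

theorem isUnit_heckeT (h : IsFoldingLength S (ℓ S)) (w : W) : IsUnit (heckeT S φ w) := by
  induction hn : ℓ S w using Nat.strong_induction_on generalizing w with
  | _ n ih =>
    by_cases hw : w = 1
    · rw [hw, heckeT_one]; exact isUnit_one
    · obtain ⟨s, hs, hlt⟩ := h.desc w hw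
      have e := heckeT_mul_of_lt (φ := φ) h hs (w := s * w) (by rwa [h.cancel hs])
      rw [h.cancel hs] at e
      rw [← e]
      exact IsUnit.mul ⟨⟨_, _, heckeT_simple_mul_inv hs, heckeT_simple_inv_mul hs⟩, rfl⟩
        (ih _ (hn ▸ hlt) _ rfl)

/-- `T_w` as a unit. -/
noncomputable def heckeUnit (h : IsFoldingLength S (ℓ S)) (φ : W → Γ) (w : W) :
    (HeckeAlgebra S φ)ˣ := (isUnit_heckeT h w).unit

@[simp]
theorem coe_heckeUnit (h : IsFoldingLength S (ℓ S)) (w : W) :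
    (heckeUnit h φ w : HeckeAlgebra S φ) = heckeT S φ w := rfl

theorem heckeUnit_one (h : IsFoldingLength S (ℓ S)) : heckeUnit h φ 1 = 1 :=
  Units.ext heckeT_one

theorem heckeUnit_mul (h : IsFoldingLength S (ℓ S)) {v w : W}
    (hvw : ℓ S (v * w) = ℓ S v + ℓ S w) :
    heckeUnit h φ v * heckeUnit h φ w = heckeUnit h φ (v * w) :=
  Units.ext (heckeT_mul hvw)

theorem coe_inv_heckeUnit (h : IsFoldingLength S (ℓ S)) {s : W} (hs : s ∈ S) :
    (((heckeUnit h φ s)⁻¹ : (HeckeAlgebra S φ)ˣ) : HeckeAlgebra S φ) =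
      heckeT S φ s - algebraMap _ _ (heckeParam φ s) :=
  Units.inv_eq_of_mul_eq_one_right (heckeT_simple_mul_inv hs)

/-- The Hecke algebra, with scalars acting through the involution of `ℤ[Γ]`. -/
def BarTwist (S : Set W) (φ : W → Γ) : Type _ := HeckeAlgebra S φ

noncomputable instance (S : Set W) (φ : W → Γ) : Ring (BarTwist S φ) :=
  inferInstanceAs (Ring (HeckeAlgebra S φ))

noncomputable instance (S : Set W) (φ : W → Γ) : Algebra (WeightRing Γ) (BarTwist S φ) :=
  RingHom.toAlgebra' (S := BarTwist S φ)
    ((algebraMap (WeightRing Γ) (HeckeAlgebra S φ)).comp (weightBar Γ))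
    fun c x => Algebra.commutes (A := HeckeAlgebra S φ) (weightBar Γ c) x

theorem exists_bar (h : IsFoldingLength S (ℓ S)) (φ : W → Γ) :
    ∃ b : HeckeAlgebra S φ →+* HeckeAlgebra S φ,
      (∀ γ, b (algebraMap (WeightRing Γ) _ (expo γ)) = algebraMap (WeightRing Γ) _ (expo (-γ))) ∧
      ∀ w, b (heckeT S φ w) = ((heckeUnit h φ w⁻¹)⁻¹ : (HeckeAlgebra S φ)ˣ) := by
  have halg : ∀ a, algebraMap (WeightRing Γ) (BarTwist S φ) a =
      algebraMap (WeightRing Γ) (HeckeAlgebra S φ) (weightBar Γ a) := fun _ => rfl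
  let T' : W → BarTwist S φ := fun w =>
    (((heckeUnit h φ w⁻¹)⁻¹ : (HeckeAlgebra S φ)ˣ) : HeckeAlgebra S φ)
  have hrel : ∀ ⦃x y⦄, HeckeRel S φ x y →
      FreeAlgebra.lift (WeightRing Γ) T' x = FreeAlgebra.lift (WeightRing Γ) T' y := by
    intro x y hxy
    induction hxy with
    | one =>
      rw [FreeAlgebra.lift_ι_apply, map_one]
      change (((heckeUnit h φ 1⁻¹)⁻¹ : (HeckeAlgebra S φ)ˣ) : HeckeAlgebra S φ) = 1
      rw [inv_one, heckeUnit_one, inv_one, Units.val_one]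
    | mul w w' hw =>
      rw [map_mul, FreeAlgebra.lift_ι_apply, FreeAlgebra.lift_ι_apply, FreeAlgebra.lift_ι_apply]
      change (((heckeUnit h φ w⁻¹)⁻¹ : (HeckeAlgebra S φ)ˣ) : HeckeAlgebra S φ) *
        (((heckeUnit h φ w'⁻¹)⁻¹ : (HeckeAlgebra S φ)ˣ) : HeckeAlgebra S φ) =
        (((heckeUnit h φ (w * w')⁻¹)⁻¹ : (HeckeAlgebra S φ)ˣ) : HeckeAlgebra S φ)
      rw [← Units.val_mul, ← mul_inv_rev, heckeUnit_mul h, mul_inv_rev]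
      rw [← mul_inv_rev, h.inv, h.inv, h.inv, hw, add_comm]
    | quad s hs =>
      rw [map_mul, map_sub, map_add, map_zero, FreeAlgebra.lift_ι_apply, AlgHom.commutes,
        AlgHom.commutes, halg, halg, weightBar_expo, weightBar_expo, neg_neg]
      have e : T' s = (heckeT S φ s - algebraMap _ _ (expo (φ s)) + algebraMap _ _ (expo (-φ s)) :
          HeckeAlgebra S φ) := by
        change (((heckeUnit h φ s⁻¹)⁻¹ : (HeckeAlgebra S φ)ˣ) : HeckeAlgebra S φ) = _
        rw [h.inv_eq hs, coe_inv_heckeUnit h hs, heckeParam, map_sub (algebraMap _ _) (expo (φ s))]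
        abel
      rw [e]
      have e1 : heckeT S φ s - algebraMap _ _ (expo (φ s)) + algebraMap _ _ (expo (-φ s)) -
        algebraMap _ _ (expo (-φ s)) = heckeT S φ s - algebraMap _ _ (expo (φ s)) := by abel
      have e2 : heckeT S φ s - algebraMap _ _ (expo (φ s)) + algebraMap _ _ (expo (-φ s)) +
        algebraMap _ _ (expo (φ s)) = heckeT S φ s + algebraMap _ _ (expo (-φ s)) := by abel
      exact (congrArg₂ (· * ·) e1 e2).trans (heckeT_quad hs)
  let b : HeckeAlgebra S φ →ₐ[WeightRing Γ] BarTwist S φ :=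
    RingQuot.liftAlgHom (WeightRing Γ) ⟨FreeAlgebra.lift (WeightRing Γ) T', hrel⟩
  refine ⟨b.toRingHom, fun γ => ?_, fun w => ?_⟩
  · exact (b.commutes _).trans (by rw [halg, weightBar_expo])
  · change b (heckeT S φ w) = T' w
    simp [b, heckeT]

theorem exists_isBarInvolution (h : IsFoldingLength S (ℓ S)) (φ : W → Γ) :
    ∃ b, IsBarInvolution S φ b := by
  obtain ⟨b, hb, hT⟩ := exists_bar h φ
  have h1 : ∀ w : W, b (heckeT S φ w) * heckeT S φ w⁻¹ = 1 := fun w => by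
    rw [hT, ← coe_heckeUnit h, Units.inv_mul]
  have h2 : ∀ w : W, heckeT S φ w⁻¹ * b (heckeT S φ w) = 1 := fun w => by
    rw [hT, ← coe_heckeUnit h, Units.mul_inv]
  refine ⟨b, fun x => ?_, hb, h1, h2⟩
  have : b.comp b = RingHom.id (HeckeAlgebra S φ) := by
    refine hecke_ringHom_ext (fun γ => ?_) fun w => ?_
    · simp only [RingHom.comp_apply, hb, neg_neg, RingHom.id_apply]
    · refine left_inv_eq_right_inv (a := b (heckeT S φ w⁻¹)) ?_ ?_
      · rw [RingHom.comp_apply, ← map_mul, h1, map_one]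
      · simpa using h1 w⁻¹
  exact RingHom.congr_fun this x

namespace IsBarInvolution

variable {b : HeckeAlgebra S φ →+* HeckeAlgebra S φ}

theorem unique {b' : HeckeAlgebra S φ →+* HeckeAlgebra S φ} (hb : IsBarInvolution S φ b)
    (hb' : IsBarInvolution S φ b') : b = b' :=
  hecke_ringHom_ext (f := b) (g := b') (fun γ => by rw [hb.expo, hb'.expo])
    fun w => left_inv_eq_right_inv (hb.mul_inv w) (hb'.inv_mul w)

theorem map_algebraMap (hb : IsBarInvolution S φ b) (a : WeightRing Γ) :
    b (algebraMap (WeightRing Γ) _ a) = algebraMap (WeightRing Γ) _ (weightBar Γ a) := by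
  have : b.comp (algebraMap (WeightRing Γ) (HeckeAlgebra S φ)) =
      (algebraMap (WeightRing Γ) (HeckeAlgebra S φ)).comp (weightBar Γ) :=
    weight_ringHom_ext fun γ => by
      rw [RingHom.comp_apply, RingHom.comp_apply, hb.expo, weightBar_expo]
  exact RingHom.congr_fun this a

theorem map_smul_bar (hb : IsBarInvolution S φ b) (a : WeightRing Γ) (x : HeckeAlgebra S φ) :
    b (a • x) = weightBar Γ a • b x := by
  rw [Algebra.smul_def, Algebra.smul_def, map_mul, hb.map_algebraMap]

theorem map_act (hb : IsBarInvolution S φ b) (σ : weightAut S φ) (x : HeckeAlgebra S φ) :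
    b (σ • x) = σ • b x := by
  let σ' := MulSemiringAction.toRingHom (weightAut S φ) (HeckeAlgebra S φ) σ
  have hA : ∀ a : WeightRing Γ, σ • algebraMap (WeightRing Γ) (HeckeAlgebra S φ) a =
      algebraMap (WeightRing Γ) (HeckeAlgebra S φ) a := fun a => by
    rw [Algebra.algebraMap_eq_smul_one, smul_comm σ a, smul_one]
  have : b.comp σ' = σ'.comp b := by
    refine hecke_ringHom_ext (fun γ => ?_) fun w => ?_
    · change b (σ • _) = σ • b _
      rw [hA, hb.expo, hA]
    · change b (σ • _) = σ • b _
      rw [smul_heckeT]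
      refine left_inv_eq_right_inv (hb.mul_inv _) ?_
      rw [← smul_inv', ← smul_heckeT, ← smul_mul', hb.inv_mul, smul_one]
  exact RingHom.congr_fun this x

/-- The bar involution is unitriangular with respect to the length. -/
theorem sub_heckeT_mem (h : IsFoldingLength S (ℓ S)) (hb : IsBarInvolution S φ b) (w : W) :
    b (heckeT S φ w) - heckeT S φ w ∈
      Submodule.span (WeightRing Γ) (heckeT S φ '' {x | ℓ S x < ℓ S w}) := by
  induction hn : ℓ S w using Nat.strong_induction_on generalizing w with
  | _ n ih =>
    by_cases hw : w = 1
    · rw [hw, heckeT_one, map_one, sub_self (1 : HeckeAlgebra S φ)]; exact zero_mem _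
    · obtain ⟨s, hs, hlt⟩ := h.desc w hw
      have e := heckeT_mul_of_lt (φ := φ) h hs (w := s * w) (by rwa [h.cancel hs])
      rw [h.cancel hs] at e
      have hbs : b (heckeT S φ s) = heckeT S φ s - algebraMap _ _ (heckeParam φ s) := by
        refine left_inv_eq_right_inv (hb.mul_inv s) ?_
        rw [h.inv_eq hs, heckeT_simple_mul_inv hs]
      have hr := ih _ (hn ▸ hlt) (s * w) rfl
      set r := b (heckeT S φ (s * w)) - heckeT S φ (s * w) with hr'
      have hv : b (heckeT S φ (s * w)) = heckeT S φ (s * w) + r := by rw [hr']; abel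
      have e2 : b (heckeT S φ w) - heckeT S φ w =
          heckeT S φ s * r - heckeParam φ s • heckeT S φ (s * w) - heckeParam φ s • r := by
        rw [← e, map_mul, hbs, hv, sub_mul (heckeT S φ s), mul_add, mul_add, ← Algebra.smul_def,
          ← Algebra.smul_def]
        abel
      rw [e2]
      have hsub : {x | ℓ S x < ℓ S (s * w)} ⊆ {x | ℓ S x < n} := fun x hx =>
        lt_trans hx (hn ▸ hlt)
      have g1 : heckeParam φ s • heckeT S φ (s * w) ∈
          Submodule.span (WeightRing Γ) (heckeT S φ '' {x | ℓ S x < n}) :=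
        Submodule.smul_mem _ _
          (Submodule.subset_span ⟨_, show ℓ S (s * w) < n from hn ▸ hlt, rfl⟩)
      have g2 : heckeParam φ s • r ∈
          Submodule.span (WeightRing Γ) (heckeT S φ '' {x | ℓ S x < n}) :=
        Submodule.smul_mem _ _ (Submodule.span_mono (Set.image_mono hsub) hr)
      refine Submodule.sub_mem (R := WeightRing Γ) (M := HeckeAlgebra S φ) _
        (Submodule.sub_mem (R := WeightRing Γ) (M := HeckeAlgebra S φ) _ ?_ g1) g2
      refine span_heckeT_mul_mem h hs (fun x hx => ?_) hsub hr
      have h1 := h.wordLength_step hs x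
      change ℓ S x < ℓ S (s * w) at hx
      change ℓ S (s * x) < n
      omega

theorem repr_heckeT (h : IsFoldingLength S (ℓ S)) (hφ : IsWeightFunction S φ)
    (hb : IsBarInvolution S φ b) {x y : W} (hxy : ℓ S y ≤ ℓ S x) :
    (heckeBasis h hφ).repr (b (heckeT S φ y)) x = Finsupp.single y 1 x := by
  have h1 := hb.sub_heckeT_mem h y
  have h2 : (heckeT S φ : W → _) = heckeBasis h hφ := funext fun w => (heckeBasis_apply h hφ w).symm
  rw [h2, Module.Basis.mem_span_image, ← h2] at h1
  by_contra hne
  have h3 : x ∈ ((heckeBasis h hφ).repr (b (heckeT S φ y) - heckeT S φ y)).support := by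
    rw [Finsupp.mem_support_iff, map_sub _ (b (heckeT S φ y)), Finsupp.sub_apply, heckeBasis_repr_heckeT]
    exact sub_ne_zero.2 hne
  have h4 : ℓ S x < ℓ S y := h1 h3
  omega

/-- The coefficients of `b v` of highest length are the conjugates of those of `v`, modulo `n`. -/
theorem dvd_repr_sub (h : IsFoldingLength S (ℓ S)) (hφ : IsWeightFunction S φ)
    (hb : IsBarInvolution S φ b) (n : ℕ) {x : W} {v : HeckeAlgebra S φ}
    (hv : ∀ y, ℓ S x < ℓ S y → (n : WeightRing Γ) ∣ (heckeBasis h hφ).repr v y) :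
    (n : WeightRing Γ) ∣ (heckeBasis h hφ).repr (b v) x -
      weightBar Γ ((heckeBasis h hφ).repr v x) := by
  classical
  have e : b v = ∑ y ∈ insert x ((heckeBasis h hφ).repr v).support,
      weightBar Γ ((heckeBasis h hφ).repr v y) • b (heckeT S φ y) := by
    conv_lhs => rw [← (heckeBasis h hφ).linearCombination_repr v,
      Finsupp.linearCombination_apply, Finsupp.sum_of_support_subset _
        (Finset.subset_insert x _) _ (by simp), map_sum]
    exact Finset.sum_congr rfl fun y _ => by rw [hb.map_smul_bar, heckeBasis_apply]
  rw [e, map_sum, Finsupp.finsetSum_apply, ← Finset.add_sum_erase _ _ (Finset.mem_insert_self x _),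
    map_smul, Finsupp.smul_apply, hb.repr_heckeT h hφ le_rfl, Finsupp.single_eq_same,
    smul_eq_mul, mul_one, add_sub_cancel_left]
  refine Finset.dvd_sum fun y hy => ?_
  rw [map_smul, Finsupp.smul_apply, smul_eq_mul]
  rcases lt_or_ge (ℓ S x) (ℓ S y) with hlt | hge
  · obtain ⟨c, hc⟩ := hv y hlt
    rw [hc, map_mul, map_natCast, mul_assoc]
    exact Dvd.intro _ rfl
  · rw [hb.repr_heckeT h hφ hge, Finsupp.single_eq_of_ne (Finset.ne_of_mem_erase hy).symm, mul_zero]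
    exact dvd_zero _

end IsBarInvolution

end BarInvolution

/-! ## Kazhdan-Lusztig elements -/

section KazhdanLusztig

variable {W Γ : Type*} [Group W] [AddCommGroup Γ] {S : Set W} {φ : W → Γ}

local notation "ℓ" => wordLength

theorem repr_sub_apply (h : IsFoldingLength S (ℓ S)) (hφ : IsWeightFunction S φ)
    (x y : HeckeAlgebra S φ) (w : W) :
    (heckeBasis h hφ).repr (x - y) w = (heckeBasis h hφ).repr x w - (heckeBasis h hφ).repr y w := by
  rw [map_sub _ x y, Finsupp.sub_apply]

theorem hecke_exists_nsmul_iff (h : IsFoldingLength S (ℓ S)) (hφ : IsWeightFunction S φ) (n : ℕ)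
    (x : HeckeAlgebra S φ) :
    (∃ y, x = n • y) ↔ ∀ w, (n : WeightRing Γ) ∣ (heckeBasis h hφ).repr x w :=
  exists_nsmul_iff_dvd_repr (heckeBasis h hφ) n x

theorem mem_span_length_lt (h : IsFoldingLength S (ℓ S)) (hφ : IsWeightFunction S φ) (n : ℕ)
    (x : HeckeAlgebra S φ) :
    x ∈ Submodule.span (WeightRing Γ) (heckeT S φ '' {w | ℓ S w < n}) ↔
      ∀ w, n ≤ ℓ S w → (heckeBasis h hφ).repr x w = 0 := by
  have h2 : (heckeT S φ : W → _) = heckeBasis h hφ := funext fun w => (heckeBasis_apply h hφ w).symm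
  rw [h2, Module.Basis.mem_span_image]
  constructor
  · intro hx w hw
    by_contra hne
    have : ℓ S w < n := hx (Finsupp.mem_support_iff.2 hne)
    omega
  · intro hx w hw
    change ℓ S w < n
    by_contra hlt
    exact Finsupp.mem_support_iff.1 hw (hx w (by omega))

namespace IsBarInvolution

variable {b : HeckeAlgebra S φ →+* HeckeAlgebra S φ}

theorem repr_top (h : IsFoldingLength S (ℓ S)) (hφ : IsWeightFunction S φ)
    (hb : IsBarInvolution S φ b) {x : W} {v : HeckeAlgebra S φ}
    (hv : ∀ y, ℓ S x < ℓ S y → (heckeBasis h hφ).repr v y = 0) :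
    (heckeBasis h hφ).repr (b v) x = weightBar Γ ((heckeBasis h hφ).repr v x) := by
  have := hb.dvd_repr_sub h hφ 0 (x := x) (v := v) (fun y hy => by rw [hv y hy]; exact dvd_zero _)
  rw [Nat.cast_zero, zero_dvd_iff] at this
  exact sub_eq_zero.1 this

end IsBarInvolution

theorem single_smul_mem {M : Type*} [AddCommGroup M] [Module (WeightRing Γ) M] (N : AddSubgroup M)
    {γ : Γ} {m : M} (hm : expo γ • m ∈ N) (k : ℤ) : AddMonoidAlgebra.single γ k • m ∈ N := by
  have e : AddMonoidAlgebra.single γ k = k • expo γ := by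
    rw [AddMonoidAlgebra.smul_single, smul_eq_mul, mul_one]
  rw [e, smul_assoc]
  exact AddSubgroup.zsmul_mem _ hm k

variable [LinearOrder Γ]

theorem mem_heckeNeg_iff (h : IsFoldingLength S (ℓ S)) (hφ : IsWeightFunction S φ)
    (x : HeckeAlgebra S φ) :
    x ∈ heckeNeg S φ ↔ ∀ w γ, 0 ≤ γ → ((heckeBasis h hφ).repr x w).coeff γ = 0 := by
  classical
  constructor
  · intro hx
    induction hx using AddSubgroup.closure_induction with
    | mem x hx =>
      obtain ⟨δ, v, hδ, rfl⟩ := hx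
      intro w γ hγ
      rw [map_smul, heckeBasis_repr_heckeT, Finsupp.smul_single, smul_eq_mul, mul_one,
        Finsupp.single_apply]
      split_ifs
      · rw [AddMonoidAlgebra.coeff_single, Finsupp.single_eq_of_ne]
        exact (hδ.trans_le hγ).ne'
      · rfl
    | zero => intro w γ _; rw [map_zero]; rfl
    | add x y _ _ hx hy =>
      intro w γ hγ
      rw [map_add, Finsupp.add_apply, AddMonoidAlgebra.coeff_add, Finsupp.add_apply, hx w γ hγ,
        hy w γ hγ, add_zero]
    | neg x _ hx =>
      intro w γ hγ
      rw [map_neg _ x, Finsupp.neg_apply, AddMonoidAlgebra.coeff_neg, Finsupp.neg_apply, hx w γ hγ,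
        neg_zero]
  · intro hx
    rw [← (heckeBasis h hφ).linearCombination_repr x, Finsupp.linearCombination_apply, Finsupp.sum]
    refine AddSubgroup.sum_mem (G := HeckeAlgebra S φ) _ fun w _ => ?_
    rw [← AddMonoidAlgebra.sum_coeff_single ((heckeBasis h hφ).repr x w), Finsupp.sum,
      Finset.sum_smul, heckeBasis_apply]
    refine AddSubgroup.sum_mem (G := HeckeAlgebra S φ) _ fun γ hγ => ?_
    have hγ0 : γ < 0 := by
      by_contra hge
      exact Finsupp.mem_support_iff.1 hγ (hx w γ (not_lt.1 hge))
    have hm : expo γ • heckeT S φ w ∈ heckeNeg S φ :=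
      AddSubgroup.subset_closure ⟨γ, w, hγ0, rfl⟩
    exact single_smul_mem (Γ := Γ) (M := HeckeAlgebra S φ) (heckeNeg S φ) hm _

/-- The part of an element of `ℤ[Γ]` which is supported on negative elements. -/
noncomputable def weightNegPart (a : WeightRing Γ) : WeightRing Γ :=
  .ofCoeff (a.coeff.filter (· < 0))

theorem coeff_negPart_of_neg (a : WeightRing Γ) {γ : Γ} (hγ : γ < 0) :
    (weightNegPart a).coeff γ = a.coeff γ :=
  Finsupp.filter_apply_pos _ _ hγ

theorem coeff_negPart_of_nonneg (a : WeightRing Γ) {γ : Γ} (hγ : 0 ≤ γ) :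
    (weightNegPart a).coeff γ = 0 :=
  Finsupp.filter_apply_neg _ _ hγ.not_gt

theorem weightNegPart_zero : weightNegPart (0 : WeightRing Γ) = 0 := by
  ext γ
  rcases lt_or_ge γ 0 with hγ | hγ
  · exact coeff_negPart_of_neg _ hγ
  · exact coeff_negPart_of_nonneg _ hγ

variable [IsOrderedAddMonoid Γ]

theorem weightNegPart_sub_weightBar (a : WeightRing Γ) (ha : weightBar Γ a = -a) :
    weightNegPart a - weightBar Γ (weightNegPart a) = a := by
  ext γ
  have h1 : a.coeff (-γ) = -a.coeff γ := by
    rw [← coeff_weightBar, ha]; rfl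
  rw [AddMonoidAlgebra.coeff_sub, Finsupp.sub_apply, coeff_weightBar]
  rcases lt_trichotomy γ 0 with hγ | hγ | hγ
  · rw [coeff_negPart_of_neg _ hγ, coeff_negPart_of_nonneg _ (neg_pos.2 hγ).le, sub_zero]
  · subst hγ
    rw [neg_zero] at h1 ⊢
    rw [sub_self]
    omega
  · rw [coeff_negPart_of_nonneg _ hγ.le, coeff_negPart_of_neg _ (neg_lt_zero.2 hγ), h1]
    simp

namespace IsBarInvolution

variable {b : HeckeAlgebra S φ →+* HeckeAlgebra S φ}

/-- An element of `H_{<0}` which is bar invariant modulo `n` is divisible by `n`. -/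
theorem exists_nsmul_of_neg (h : IsFoldingLength S (ℓ S)) (hφ : IsWeightFunction S φ)
    (hb : IsBarInvolution S φ b) (n : ℕ) {x : HeckeAlgebra S φ} (hx : x ∈ heckeNeg S φ)
    (hbx : ∃ y, b x - x = n • y) : ∃ y, x = n • y := by
  rw [hecke_exists_nsmul_iff h hφ] at hbx ⊢
  rw [mem_heckeNeg_iff h hφ] at hx
  by_contra hne
  push Not at hne
  have hfin : {w | ¬ (n : WeightRing Γ) ∣ (heckeBasis h hφ).repr x w}.Finite := by
    refine ((heckeBasis h hφ).repr x).support.finite_toSet.subset fun w hw => ?_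
    refine Finsupp.mem_support_iff.2 fun h0 => hw ?_
    rw [h0]
    exact dvd_zero _
  obtain ⟨w, hw, hmax⟩ := Set.exists_max_image _ (ℓ S) hfin hne
  refine hw ((natCast_dvd_iff n _).2 fun γ => ?_)
  have h1 := hb.dvd_repr_sub h hφ n (x := w) (v := x) fun y hy => by
    by_contra hy'
    have := hmax y hy'
    omega
  have h2 := hbx w
  rw [repr_sub_apply] at h2
  have h3 := dvd_sub h1 h2
  rw [sub_sub_sub_cancel_left, natCast_dvd_iff] at h3
  have h4 := h3 γ
  rw [AddMonoidAlgebra.coeff_sub, Finsupp.sub_apply, coeff_weightBar] at h4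
  rcases lt_or_ge γ 0 with hγ | hγ
  · rwa [hx w _ (neg_pos.2 hγ).le, sub_zero] at h4
  · rw [hx w γ hγ]
    exact dvd_zero _

/-- Anti-invariant elements are of the form `u - b u`, with `u` in `H_{<0}`. -/
theorem exists_neg_sub_eq (h : IsFoldingLength S (ℓ S)) (hφ : IsWeightFunction S φ)
    (hb : IsBarInvolution S φ b) (n : ℕ) (x : HeckeAlgebra S φ)
    (hx : ∀ w, n ≤ ℓ S w → (heckeBasis h hφ).repr x w = 0) (hbx : b x = -x) :
    ∃ u ∈ heckeNeg S φ, u - b u = x := by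
  induction n generalizing x with
  | zero =>
    have : x = 0 := (heckeBasis h hφ).repr.map_eq_zero_iff.1 (Finsupp.ext fun w => hx w (by omega))
    refine ⟨0, zero_mem _, ?_⟩
    rw [this, map_zero]
    exact sub_self (0 : HeckeAlgebra S φ)
  | succ n ih =>
    let v : HeckeAlgebra S φ :=
      (heckeBasis h hφ).repr.symm (((heckeBasis h hφ).repr x).mapRange weightNegPart weightNegPart_zero)
    have hv : ∀ w, (heckeBasis h hφ).repr v w = weightNegPart ((heckeBasis h hφ).repr x w) := fun w => by
      rw [LinearEquiv.apply_symm_apply, Finsupp.mapRange_apply]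
    have hvn : v ∈ heckeNeg S φ := by
      rw [mem_heckeNeg_iff h hφ]
      intro w γ hγ
      rw [hv, coeff_negPart_of_nonneg _ hγ]
    have hv0 : ∀ w, n + 1 ≤ ℓ S w → (heckeBasis h hφ).repr v w = 0 := fun w hw => by
      rw [hv, hx w hw, weightNegPart_zero]
    have key : ∀ w, n ≤ ℓ S w → (heckeBasis h hφ).repr (x - (v - b v)) w = 0 := by
      intro w hw
      have e1 := hb.repr_top h hφ (x := w) (v := v) fun y hy => hv0 y (by omega)
      have e2 := hb.repr_top h hφ (x := w) (v := x) fun y hy => hx y (by omega)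
      rw [hbx, map_neg _ x, Finsupp.neg_apply] at e2
      rw [repr_sub_apply, repr_sub_apply, e1, hv, weightNegPart_sub_weightBar _ e2.symm, sub_self]
    obtain ⟨u, hu, hu'⟩ := ih _ key (by
      rw [map_sub b x, map_sub b v, hb.involutive, hbx]
      abel)
    refine ⟨u + v, add_mem hu hvn, ?_⟩
    rw [map_add]
    have : u + v - (b u + b v) = (u - b u) + (v - b v) := by abel
    rw [this, hu']
    exact sub_add_cancel x (v - b v)

end IsBarInvolution

/-- Existence and uniqueness of the Kazhdan-Lusztig elements. -/
theorem existsUnique_isKLElement (h : IsFoldingLength S (ℓ S)) (hφ : IsWeightFunction S φ) (w : W) :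
    ∃! C, IsKLElement S φ w C := by
  obtain ⟨b, hb⟩ := exists_isBarInvolution h φ
  refine existsUnique_of_exists_of_unique ?_ ?_
  · obtain ⟨u, hu, hu'⟩ := hb.exists_neg_sub_eq h hφ (ℓ S w) (b (heckeT S φ w) - heckeT S φ w)
      ((mem_span_length_lt h hφ _ _).1 (hb.sub_heckeT_mem h w)) (by
        rw [map_sub b (b _), hb.involutive]
        abel)
    refine ⟨heckeT S φ w + u, ⟨b, hb, ?_⟩, ?_⟩
    · rw [map_add, add_comm (heckeT S φ w) u]
      exact ((sub_eq_sub_iff_add_eq_add (G := HeckeAlgebra S φ)).1 hu').symm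
    · rwa [add_sub_cancel_left (heckeT S φ w) u]
  · rintro C C' ⟨⟨b₁, hb₁, hC⟩, hCn⟩ ⟨⟨b₂, hb₂, hC'⟩, hCn'⟩
    rw [hb₁.unique hb] at hC
    rw [hb₂.unique hb] at hC'
    have hn := AddSubgroup.sub_mem _ hCn hCn'
    rw [sub_sub_sub_cancel_right C C' (heckeT S φ w)] at hn
    obtain ⟨y, hy⟩ := hb.exists_nsmul_of_neg h hφ 0 hn ⟨0, by
      rw [map_sub b C, hC, hC', sub_self (C - C'), zero_smul]⟩
    rw [zero_smul] at hy
    exact sub_eq_zero.1 hy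

end KazhdanLusztig

/-! ## The Brauer quotient of an algebra with a permutation basis -/

section PermutationBasis

variable {R M G ι : Type*} [CommRing R] [Ring M] [Algebra R M] [Group G] [MulSemiringAction G M]

theorem out_smul_eq {H : Subgroup G} {m : M} (hm : ∀ g ∈ H, g • m = m) (x : G) :
    (x : G ⧸ H).out • m = x • m := by
  obtain ⟨g, hg⟩ := QuotientGroup.mk_out_eq_mul H x
  rw [hg, mul_smul, hm _ g.2]

theorem smul_relTrace [Finite G] {H : Subgroup G} {m : M} (hm : ∀ g ∈ H, g • m = m) (g : G) :
    g • relTrace H m = relTrace H m := by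
  have := Fintype.ofFinite (G ⧸ H)
  simp only [relTrace, finsum_eq_sum_of_fintype]
  rw [Finset.smul_sum]
  refine Fintype.sum_equiv (MulAction.toPerm g) _ _ fun q => ?_
  rw [← mul_smul, MulAction.toPerm_apply]
  have e : g • q = ((g * q.out : G) : G ⧸ H) := by
    conv_lhs => rw [← QuotientGroup.out_eq' q]
    rfl
  rw [e, out_smul_eq hm]

variable [SMulCommClass G R M] [MulAction G ι]

theorem repr_smul (b : Module.Basis ι R M) (hb : ∀ (g : G) i, g • b i = b (g • i)) (g : G) (m : M)
    (i : ι) : b.repr (g • m) i = b.repr m (g⁻¹ • i) := by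
  have : b.repr.toLinearMap ∘ₗ DistribSMul.toLinearMap R M g =
      Finsupp.lmapDomain R R (g • ·) ∘ₗ b.repr.toLinearMap :=
    b.ext fun i => by simp [hb]
  have h := LinearMap.congr_fun this m
  simp only [LinearMap.comp_apply, LinearEquiv.coe_coe, DistribSMul.toLinearMap_apply,
    Finsupp.lmapDomain_apply] at h
  rw [h]
  conv_lhs => rw [← smul_inv_smul g i]
  exact Finsupp.mapDomain_apply (MulAction.injective g) _ _

theorem repr_relTrace [Finite G] (b : Module.Basis ι R M) (hb : ∀ (g : G) i, g • b i = b (g • i))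
    (H : Subgroup G) [Fintype (G ⧸ H)] (m : M) (i : ι) :
    b.repr (relTrace H m) i = ∑ q : G ⧸ H, b.repr m (q.out⁻¹ • i) := by
  rw [relTrace, finsum_eq_sum_of_fintype, map_sum, Finsupp.finsetSum_apply]
  exact Finset.sum_congr rfl fun q _ => repr_smul b hb _ _ _

theorem repr_relTrace_of_fixed [Finite G] (b : Module.Basis ι R M)
    (hb : ∀ (g : G) i, g • b i = b (g • i)) (H : Subgroup G) (m : M) {i : ι}
    (hi : ∀ g : G, g • i = i) : b.repr (relTrace H m) i = (H.index : R) * b.repr m i := by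
  have := Fintype.ofFinite (G ⧸ H)
  rw [repr_relTrace b hb]
  simp only [hi]
  rw [Finset.sum_const, nsmul_eq_mul, Finset.card_univ, ← Nat.card_eq_fintype_card, Subgroup.index]

theorem dvd_index {p : ℕ} (hp : p.Prime) [Finite G] (hG : IsPGroup p G) {H : Subgroup G}
    (hH : H < ⊤) : p ∣ H.index := by
  have := Fact.mk hp
  obtain ⟨n, hn⟩ := hG.index H
  rw [hn]
  refine dvd_pow_self p fun h0 => ?_
  rw [h0, pow_zero, Subgroup.index_eq_one] at hn
  exact hH.ne hn

theorem exists_index_eq {p : ℕ} (hp : p.Prime) [Finite G] [Nontrivial G] (hG : IsPGroup p G) :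
    ∃ H : Subgroup G, H < ⊤ ∧ H.index = p := by
  have := Fact.mk hp
  obtain ⟨n, hn⟩ := IsPGroup.iff_card.1 hG
  have hn0 : n ≠ 0 := by
    rintro rfl
    exact Finite.one_lt_card.ne' hn
  obtain ⟨k, rfl⟩ := Nat.exists_eq_succ_of_ne_zero hn0
  obtain ⟨H, hH⟩ := Sylow.exists_subgroup_card_pow_prime (G := G) p (n := k)
    (by rw [hn]; exact pow_dvd_pow p k.le_succ)
  have h1 := H.card_mul_index
  rw [hn, hH, pow_succ] at h1
  have h2 : H.index = p := Nat.eq_of_mul_eq_mul_left (pow_pos hp.pos k) h1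
  refine ⟨H, lt_top_iff_ne_top.2 ?_, h2⟩
  rintro rfl
  rw [Subgroup.index_top] at h2
  exact hp.one_lt.ne h2

theorem repr_relTrace_stabilizer [Finite G] (b : Module.Basis ι R M)
    (hb : ∀ (g : G) i, g • b i = b (g • i)) (i : ι) (c : R) :
    b.repr (relTrace (MulAction.stabilizer G i) (c • b i)) i = c := by
  classical
  have := Fintype.ofFinite (G ⧸ MulAction.stabilizer G i)
  rw [repr_relTrace b hb, Finset.sum_eq_single ((1 : G) : G ⧸ MulAction.stabilizer G i)]
  · obtain ⟨g, hg⟩ := QuotientGroup.mk_out_eq_mul (MulAction.stabilizer G i) 1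
    have : ((1 : G) : G ⧸ MulAction.stabilizer G i).out⁻¹ • i = i := by
      rw [inv_smul_eq_iff, hg, one_mul]
      exact (MulAction.mem_stabilizer_iff.1 g.2).symm
    rw [this]
    simp
  · intro q _ hq
    have : q.out⁻¹ • i ≠ i := by
      intro h
      apply hq
      rw [← QuotientGroup.out_eq' q]
      refine QuotientGroup.eq.2 ?_
      rw [mul_one]
      exact h
    simp [this.symm]
  · simp

theorem repr_relTrace_of_notMem_orbit [Finite G] (b : Module.Basis ι R M)
    (hb : ∀ (g : G) i, g • b i = b (g • i)) (H : Subgroup G) (i j : ι) (c : R)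
    (hj : j ∉ MulAction.orbit G i) : b.repr (relTrace H (c • b i)) j = 0 := by
  classical
  have := Fintype.ofFinite (G ⧸ H)
  rw [repr_relTrace b hb]
  refine Finset.sum_eq_zero fun q _ => ?_
  have : i ≠ q.out⁻¹ • j := by
    intro h
    exact hj ⟨q.out, by simp [h]⟩
  simp [this]

/-- An invariant lies in the trace ideal if and only if `p` divides its coefficients at the fixed
points of the permutation basis. -/
theorem mem_traceIdeal_iff [Finite G] [Nontrivial G] {p : ℕ} (hp : p.Prime) (hG : IsPGroup p G)
    (b : Module.Basis ι R M) (hb : ∀ (g : G) i, g • b i = b (g • i))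
    (m : FixedPoints.subalgebra R M G) :
    m ∈ traceIdeal R M G ↔ ∀ i, (∀ g : G, g • i = i) → (p : R) ∣ b.repr (m : M) i := by
  classical
  change m ∈ Submodule.span R (properTraces R M G) ↔ _
  constructor
  · intro hm i hi
    induction hm using Submodule.span_induction with
    | mem x hx =>
      obtain ⟨H, hH, y, hy, hx⟩ := hx
      rw [hx, repr_relTrace_of_fixed b hb H y hi]
      exact (Nat.cast_dvd_cast (dvd_index hp hG hH)).mul_right _
    | zero => simp
    | add x y _ _ hx hy =>
      rw [AddMemClass.coe_add, map_add, Finsupp.add_apply]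
      exact dvd_add hx hy
    | smul r x _ hx =>
      have : ((r • x : FixedPoints.subalgebra R M G) : M) = r • (x : M) := rfl
      rw [this, map_smul, Finsupp.smul_apply, smul_eq_mul]
      exact hx.mul_left _
  · intro hm
    induction hn : (b.repr (m : M)).support.card using Nat.strong_induction_on generalizing m with
    | _ n ih =>
      by_cases h0 : (m : M) = 0
      · have : m = 0 := Subtype.ext h0
        rw [this]
        exact zero_mem _
      · have hne : b.repr (m : M) ≠ 0 := by simpa using h0
        obtain ⟨i, hi⟩ := Finsupp.support_nonempty_iff.2 hne
        have step : ∀ (H : Subgroup G) (c : R), H < ⊤ → (∀ g ∈ H, g • (c • b i) = c • b i) →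
            (∀ j, (∀ g : G, g • j = j) → (p : R) ∣ b.repr (relTrace H (c • b i)) j) →
            b.repr (relTrace H (c • b i)) i = b.repr (m : M) i →
            m ∈ Submodule.span R (properTraces R M G) := by
          intro H c hH hfix hdvd heq
          let t : FixedPoints.subalgebra R M G := ⟨relTrace H (c • b i), smul_relTrace hfix⟩
          have ht : t ∈ Submodule.span R (properTraces R M G) :=
            Submodule.subset_span ⟨H, hH, c • b i, hfix, rfl⟩
          have hsub : ((m - t : FixedPoints.subalgebra R M G) : M) =
              (m : M) - relTrace H (c • b i) := rfl
          have hmt : m - t ∈ Submodule.span R (properTraces R M G) := by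
            refine ih _ ?_ (m - t) (fun j hj => ?_) rfl
            · rw [← hn]
              refine Finset.card_lt_card ((Finset.ssubset_iff_of_subset fun j hj => ?_).2
                ⟨i, hi, ?_⟩)
              · rw [Finsupp.mem_support_iff, hsub, map_sub, Finsupp.sub_apply] at hj
                rw [Finsupp.mem_support_iff]
                intro hj0
                by_cases hmem : j ∈ MulAction.orbit G i
                · obtain ⟨g, rfl⟩ := hmem
                  refine Finsupp.mem_support_iff.1 hi ?_
                  have hrs := repr_smul b hb g (m : M) (g • i)
                  rw [m.2 g, inv_smul_smul] at hrs
                  exact hrs.symm.trans hj0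
                · rw [hj0, repr_relTrace_of_notMem_orbit b hb H i j c hmem, sub_zero] at hj
                  exact hj rfl
              · rw [Finsupp.notMem_support_iff, hsub, map_sub, Finsupp.sub_apply, heq, sub_self]
            · rw [hsub, map_sub, Finsupp.sub_apply]
              exact dvd_sub (hm j hj) (hdvd j hj)
          have := add_mem hmt ht
          rwa [sub_add_cancel] at this
        by_cases hfix : ∀ g : G, g • i = i
        · obtain ⟨H, hH, hind⟩ := exists_index_eq hp hG
          obtain ⟨c, hc⟩ := hm i hfix
          refine step H c hH (fun g _ => by rw [smul_comm g c, hb, hfix]) (fun j hj => ?_) ?_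
          · rw [repr_relTrace_of_fixed b hb H _ hj, hind]
            exact Dvd.intro _ rfl
          · rw [repr_relTrace_of_fixed b hb H _ hfix, hind, hc]
            simp
        · have hlt : MulAction.stabilizer G i < ⊤ := by
            refine lt_top_iff_ne_top.2 fun htop => hfix fun g => ?_
            exact MulAction.mem_stabilizer_iff.1 (htop ▸ Subgroup.mem_top g)
          refine step (MulAction.stabilizer G i) (b.repr (m : M) i) hlt (fun g hg => ?_)
            (fun j hj => ?_) (repr_relTrace_stabilizer b hb i _)
          · rw [smul_comm g (b.repr (m : M) i), hb, MulAction.mem_stabilizer_iff.1 hg]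
          · rw [repr_relTrace_of_fixed b hb _ _ hj]
            exact (Nat.cast_dvd_cast (dvd_index hp hG hlt)).mul_right _

theorem brauerMap_eq_iff [Finite G] [Nontrivial G] {p : ℕ} (hp : p.Prime) (hG : IsPGroup p G)
    (b : Module.Basis ι R M) (hb : ∀ (g : G) i, g • b i = b (g • i))
    (m n : FixedPoints.subalgebra R M G) :
    brauerMap R M G m = brauerMap R M G n ↔
      ∀ i, (∀ g : G, g • i = i) → (p : R) ∣ b.repr (m : M) i - b.repr (n : M) i := by
  have e : brauerMap R M G m = brauerMap R M G n ↔ m - n ∈ traceIdeal R M G := Ideal.Quotient.eq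
  have e' : ((m - n : FixedPoints.subalgebra R M G) : M) = (m : M) - n := rfl
  rw [e, mem_traceIdeal_iff hp hG b hb, e']
  simp only [map_sub, Finsupp.sub_apply]

end PermutationBasis

section Functoriality

variable {R M G : Type*} [CommRing R] [Ring M] [Algebra R M] [Group G] [Finite G]
  [MulSemiringAction G M] [SMulCommClass G R M]

/-- Invariant linear forms are defined, modulo `p`, on the Brauer quotient. -/
theorem dvd_sub_of_brauerMap_eq {p : ℕ} (hp : p.Prime) (hG : IsPGroup p G) (f : M →ₗ[R] R)
    (hf : ∀ (g : G) m, f (g • m) = f m) {m n : FixedPoints.subalgebra R M G}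
    (hmn : brauerMap R M G m = brauerMap R M G n) : (p : R) ∣ f m - f n := by
  have key : ∀ m ∈ Submodule.span R (properTraces R M G), (p : R) ∣ f (m : M) := by
    intro m hm
    induction hm using Submodule.span_induction with
    | mem x hx =>
      obtain ⟨H, hH, y, hy, hx⟩ := hx
      have := Fintype.ofFinite (G ⧸ H)
      rw [hx, relTrace, finsum_eq_sum_of_fintype, map_sum]
      simp only [hf]
      rw [Finset.sum_const, nsmul_eq_mul, Finset.card_univ, ← Nat.card_eq_fintype_card]
      exact (Nat.cast_dvd_cast (dvd_index hp hG hH)).mul_right _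
    | zero => rw [ZeroMemClass.coe_zero, map_zero]; exact dvd_zero _
    | add x y _ _ hx hy => rw [AddMemClass.coe_add, map_add]; exact dvd_add hx hy
    | smul r x _ hx =>
      have : ((r • x : FixedPoints.subalgebra R M G) : M) = r • (x : M) := rfl
      rw [this, map_smul, smul_eq_mul]
      exact hx.mul_left _
  rw [← map_sub]
  exact key (m - n) (Ideal.Quotient.eq.1 hmn)

/-- Equivariant semilinear ring endomorphisms act on the Brauer quotient. -/
theorem exists_brauerMap_endo (f : M →+* M) (τ : R → R) (hτ : ∀ (r : R) m, f (r • m) = τ r • f m)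
    (hf : ∀ (g : G) m, f (g • m) = g • f m) :
    ∃ β : BrauerQuotient R M G →+* BrauerQuotient R M G,
      ∀ m n : FixedPoints.subalgebra R M G, (n : M) = f m →
        β (brauerMap R M G m) = brauerMap R M G n := by
  let F : FixedPoints.subalgebra R M G →+* FixedPoints.subalgebra R M G :=
    (f.comp (FixedPoints.subalgebra R M G).val.toRingHom).codRestrict _ fun m g => by
      change g • f m = f m
      rw [← hf, m.2 g]
  have hF : ∀ m ∈ traceIdeal R M G, F m ∈ traceIdeal R M G := by
    intro m hm
    change m ∈ Submodule.span R (properTraces R M G) at hm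
    change F m ∈ Submodule.span R (properTraces R M G)
    induction hm using Submodule.span_induction with
    | mem x hx =>
      obtain ⟨H, hH, y, hy, hx⟩ := hx
      have := Fintype.ofFinite (G ⧸ H)
      refine Submodule.subset_span ⟨H, hH, f y, fun g hg => by rw [← hf, hy g hg], ?_⟩
      change f x = _
      rw [hx, relTrace, relTrace, finsum_eq_sum_of_fintype, finsum_eq_sum_of_fintype, map_sum]
      exact Finset.sum_congr rfl fun q _ => hf _ _
    | zero => rw [map_zero]; exact zero_mem _
    | add x y _ _ hx hy => rw [map_add]; exact add_mem hx hy
    | smul r x _ hx =>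
      have : F (r • x) = τ r • F x := Subtype.ext (hτ r x)
      rw [this]
      exact Submodule.smul_mem _ _ hx
  refine ⟨Ideal.Quotient.lift (traceIdeal R M G)
    ((Ideal.Quotient.mk (traceIdeal R M G)).comp F) fun m hm =>
      Ideal.Quotient.eq_zero_iff_mem.2 (hF m hm), fun m n hn => ?_⟩
  have : n = F m := Subtype.ext hn
  rw [this]
  exact Ideal.Quotient.lift_mk _ _ _

end Functoriality

section FixedBasis

variable {R M G ι N κ : Type*} [CommRing R] [Ring M] [Algebra R M] [Group G] [Finite G]
  [Nontrivial G] [MulSemiringAction G M] [SMulCommClass G R M] [MulAction G ι] [AddCommGroup N]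
  [Module R N] {p : ℕ}

/-- The Brauer quotient of an algebra with a permutation basis, in terms of a module with a basis
indexed by the fixed points. -/
theorem eq_brauerMap_iff (hp : p.Prime) (hG : IsPGroup p G) (b : Module.Basis ι R M)
    (hb : ∀ (g : G) i, g • b i = b (g • i)) (b' : Module.Basis κ R N) {f : κ → ι}
    (hf : Function.Injective f) (hfix : ∀ i, (∀ g : G, g • i = i) ↔ ∃ k, f k = i)
    (can : N →ₗ[R] BrauerQuotient R M G) (t : κ → FixedPoints.subalgebra R M G)
    (ht : ∀ k, (t k : M) = b (f k)) (hcan : ∀ k, can (b' k) = brauerMap R M G (t k))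
    (n : N) (m : FixedPoints.subalgebra R M G) :
    can n = brauerMap R M G m ↔ ∀ k, (p : R) ∣ b'.repr n k - b.repr (m : M) (f k) := by
  let L : N →ₗ[R] FixedPoints.subalgebra R M G := b'.constr R t
  have hL : ∀ k, L (b' k) = t k := b'.constr_basis R t
  have h1 : can n = brauerMap R M G (L n) := by
    have : can = (brauerMap R M G).toLinearMap ∘ₗ L :=
      b'.ext fun k => by rw [hcan, LinearMap.comp_apply, hL]; rfl
    rw [this]
    rfl
  have h2 : ∀ k, b.repr (L n : M) (f k) = b'.repr n k := by
    intro k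
    have : (Finsupp.lapply (f k) ∘ₗ b.repr.toLinearMap) ∘ₗ
        ((FixedPoints.subalgebra R M G).val.toLinearMap ∘ₗ L) =
        Finsupp.lapply k ∘ₗ b'.repr.toLinearMap := by
      refine b'.ext fun k' => ?_
      simp only [LinearMap.comp_apply, hL]
      change b.repr (t k' : M) (f k) = b'.repr (b' k') k
      rw [ht, b.repr_self, b'.repr_self]
      exact Finsupp.single_apply_left hf k' k 1
    exact LinearMap.congr_fun this n
  rw [h1, brauerMap_eq_iff hp hG b hb]
  constructor
  · intro h k
    rw [← h2]
    exact h _ ((hfix _).2 ⟨k, rfl⟩)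
  · intro h i hi
    obtain ⟨k, rfl⟩ := (hfix i).1 hi
    rw [h2]
    exact h k

/-- The coordinates of `m` at the fixed points. -/
noncomputable def fixedPart (b : Module.Basis ι R M) (b' : Module.Basis κ R N) {f : κ → ι}
    (hf : Function.Injective f) (m : M) : N :=
  b'.repr.symm ((b.repr m).comapDomain f hf.injOn)

theorem repr_fixedPart (b : Module.Basis ι R M) (b' : Module.Basis κ R N) {f : κ → ι}
    (hf : Function.Injective f) (m : M) (k : κ) :
    b'.repr (fixedPart b b' hf m) k = b.repr m (f k) := by
  rw [fixedPart, LinearEquiv.apply_symm_apply, Finsupp.comapDomain_apply]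

end FixedBasis

/-- Modulo `p`, a surjective ring homomorphism with kernel generated by `p` is an isomorphism. -/
theorem exists_zmod_tensor_equiv {A B : Type*} [Ring A] [Ring B] (p : ℕ) (f : A →+* B)
    (hsurj : Function.Surjective f) (hker : ∀ a, f a = 0 ↔ ∃ a', a = p • a') :
    ∃ e : (ZMod p ⊗[ℤ] A) ≃+* B, ∀ a, e (1 ⊗ₜ[ℤ] a) = f a := by
  have hp0 : (p : B) = 0 := by
    have := (hker (p : A)).2 ⟨1, by rw [nsmul_one]⟩
    rwa [map_natCast] at this
  let j : ZMod p →+* B :=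
    (Ideal.Quotient.lift (Ideal.span {(p : ℤ)}) (Int.castRingHom B) (fun a ha => by
      obtain ⟨c, rfl⟩ := Ideal.mem_span_singleton.1 ha
      rw [map_mul, map_natCast, hp0, zero_mul])).comp
      (Int.quotientSpanNatEquivZMod p).symm.toRingHom
  have hj : ∀ z : ℤ, j z = z := fun z => map_intCast j z
  let E : ZMod p ⊗[ℤ] A →ₐ[ℤ] B :=
    Algebra.TensorProduct.lift j.toIntAlgHom f.toIntAlgHom fun x a => by
      obtain ⟨z, rfl⟩ := ZMod.intCast_surjective x
      change Commute (j z) (f a)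
      rw [hj]
      exact Int.cast_commute z _
  have hE : ∀ a, E (1 ⊗ₜ[ℤ] a) = f a := fun a => by
    simp [E]
  have hone : ∀ x : ZMod p ⊗[ℤ] A, ∃ a, x = 1 ⊗ₜ[ℤ] a := by
    intro x
    induction x using TensorProduct.induction_on with
    | zero => exact ⟨0, (TensorProduct.tmul_zero _ _).symm⟩
    | tmul x a =>
      obtain ⟨z, rfl⟩ := ZMod.intCast_surjective x
      exact ⟨z • a, by rw [← TensorProduct.smul_tmul, zsmul_one]⟩
    | add x y hx hy =>
      obtain ⟨a, rfl⟩ := hx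
      obtain ⟨a', rfl⟩ := hy
      exact ⟨a + a', (TensorProduct.tmul_add _ _ _).symm⟩
  refine ⟨RingEquiv.ofBijective E ⟨?_, ?_⟩, hE⟩
  · rw [injective_iff_map_eq_zero]
    intro x hx
    obtain ⟨a, rfl⟩ := hone x
    rw [hE, hker] at hx
    obtain ⟨a', rfl⟩ := hx
    rw [← natCast_zsmul, ← TensorProduct.smul_tmul, zsmul_one, Int.cast_natCast, ZMod.natCast_self,
      TensorProduct.zero_tmul]
  · intro y
    obtain ⟨a, rfl⟩ := hsurj y
    exact ⟨_, hE a⟩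

/-! ## Products of standard elements -/

section Products

variable {W Γ : Type*} [Group W] [AddCommGroup Γ] {S : Set W} {φ : W → Γ}

local notation "ℓ" => wordLength

open Classical in
/-- The coefficient of `T_1` is a symmetrizing form. -/
theorem repr_mul_one (h : IsFoldingLength S (ℓ S)) (hφ : IsWeightFunction S φ) (u v : W) :
    (heckeBasis h hφ).repr (heckeT S φ u * heckeT S φ v) 1 = if u * v = 1 then 1 else 0 := by
  induction hn : ℓ S u using Nat.strong_induction_on generalizing u v with
  | _ n ih =>
    by_cases hu : u = 1
    · rw [hu, heckeT_one, one_mul, one_mul, heckeBasis_repr_heckeT, Finsupp.single_apply]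
    · obtain ⟨s, hs, hlt⟩ := h.desc_right hu
      have h1 := h.step_right hs u
      rw [h.wordLength_simple hs] at h1
      have e : heckeT S φ (u * s) * heckeT S φ s = heckeT S φ u := by
        rw [heckeT_mul, h.cancel_right hs]
        rw [h.cancel_right hs, h.wordLength_simple hs]
        omega
      have hus : u * s * (s * v) = u * v := by
        rw [mul_assoc, h.cancel hs]
      rw [← e, mul_assoc]
      rcases h.lt_or_lt hs v with hv | hv
      · rw [heckeT_mul_of_lt h hs hv, ih _ (hn ▸ hlt) _ _ rfl, hus]
      · rw [heckeT_mul_of_gt h hs hv, mul_add, mul_smul_comm, map_add, Finsupp.add_apply, map_smul,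
          Finsupp.smul_apply, ih _ (hn ▸ hlt) _ _ rfl, ih _ (hn ▸ hlt) _ _ rfl, hus,
          if_neg (c := u * s * v = 1), smul_zero, add_zero]
        intro h0
        have e1 : u * s = v⁻¹ := eq_inv_of_mul_eq_one_left h0
        have e2 : u = (s * v)⁻¹ := by
          rw [mul_inv_rev, h.inv_eq hs, ← e1, h.cancel_right hs]
        rw [e1, e2, h.inv, h.inv] at hlt
        omega

theorem weight_one (h : IsFoldingLength S (ℓ S)) (hφ : IsWeightFunction S φ) : φ 1 = 0 := by
  have := hφ 1 1 (by rw [mul_one, h.one])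
  rw [mul_one] at this
  exact left_eq_add.1 this

/-- The character `T_w ↦ e^{φ(w)}` of the Hecke algebra. -/
noncomputable def weightChar (h : IsFoldingLength S (ℓ S)) (hφ : IsWeightFunction S φ) :
    HeckeAlgebra S φ →ₐ[WeightRing Γ] WeightRing Γ :=
  RingQuot.liftAlgHom (WeightRing Γ) ⟨FreeAlgebra.lift (WeightRing Γ) fun w => expo (φ w), by
    intro x y hxy
    induction hxy with
    | one => rw [FreeAlgebra.lift_ι_apply, map_one, weight_one h hφ, expo_zero]
    | mul w w' hw =>
      rw [map_mul, FreeAlgebra.lift_ι_apply, FreeAlgebra.lift_ι_apply, FreeAlgebra.lift_ι_apply,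
        expo_mul, hφ w w' hw]
    | quad s hs =>
      simp only [map_mul, map_sub, map_add, map_zero, FreeAlgebra.lift_ι_apply, AlgHom.commutes]
      rw [Algebra.algebraMap_self_apply, sub_self, zero_mul]⟩

theorem weightChar_heckeT (h : IsFoldingLength S (ℓ S)) (hφ : IsWeightFunction S φ) (w : W) :
    weightChar h hφ (heckeT S φ w) = expo (φ w) := by
  simp [weightChar, heckeT]

theorem weightChar_smul (h : IsFoldingLength S (ℓ S)) (hφ : IsWeightFunction S φ)
    (σ : weightAut S φ) (x : HeckeAlgebra S φ) : weightChar h hφ (σ • x) = weightChar h hφ x := by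
  have : (weightChar h hφ).comp (heckeAct S φ σ) = weightChar h hφ :=
    hecke_algHom_ext fun w => by
      rw [AlgHom.comp_apply, heckeAct_heckeT, weightChar_heckeT, weightChar_heckeT, σ.2.2]
  exact AlgHom.congr_fun this x

variable {G : Subgroup (weightAut S φ)} {p : ℕ}

theorem smul_heckeBasis (h : IsFoldingLength S (ℓ S)) (hφ : IsWeightFunction S φ) (g : G) (w : W) :
    g • heckeBasis h hφ w = heckeBasis h hφ (g • w) := by
  rw [heckeBasis_apply, heckeBasis_apply]
  exact smul_heckeT S φ g.1 w

theorem hecke_brauerMap_eq_iff [Finite G] [Nontrivial G] (h : IsFoldingLength S (ℓ S))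
    (hφ : IsWeightFunction S φ) (hp : p.Prime) (hG : IsPGroup p G)
    (m n : FixedPoints.subalgebra (WeightRing Γ) (HeckeAlgebra S φ) G) :
    brauerMap (WeightRing Γ) (HeckeAlgebra S φ) G m =
        brauerMap (WeightRing Γ) (HeckeAlgebra S φ) G n ↔
      ∀ w : W, (∀ g : G, g • w = w) → (p : WeightRing Γ) ∣
        (heckeBasis h hφ).repr (m : HeckeAlgebra S φ) w -
          (heckeBasis h hφ).repr (n : HeckeAlgebra S φ) w := by
  have := brauerMap_eq_iff (R := WeightRing Γ) (M := HeckeAlgebra S φ) (G := G) hp hG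
    (heckeBasis h hφ) (by
      intro g w
      exact smul_heckeBasis h hφ g w)
  exact this m n

theorem dvd_weightChar_sub [Finite G] (h : IsFoldingLength S (ℓ S))
    (hφ : IsWeightFunction S φ) (hp : p.Prime) (hG : IsPGroup p G)
    {m n : FixedPoints.subalgebra (WeightRing Γ) (HeckeAlgebra S φ) G}
    (hmn : brauerMap (WeightRing Γ) (HeckeAlgebra S φ) G m =
        brauerMap (WeightRing Γ) (HeckeAlgebra S φ) G n) :
    (p : WeightRing Γ) ∣ weightChar h hφ m - weightChar h hφ n := by
  have := fun m n => dvd_sub_of_brauerMap_eq (R := WeightRing Γ) (M := HeckeAlgebra S φ) (G := G)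
    (m := m) (n := n) hp hG (weightChar h hφ).toLinearMap (by
      intro g x
      exact weightChar_smul h hφ g.1 x)
  exact this m n hmn

end Products

/-! ## The quadratic relation in the Brauer quotient -/

section Quadratic

variable {W Γ : Type*} [Group W] [AddCommGroup Γ] {S : Set W} {φ : W → Γ}
  {G : Subgroup (weightAut S φ)} {p : ℕ}

local notation "ℓ" => wordLength

omit [AddCommGroup Γ] in
theorem group_smul_mem (g : G) : ∀ s ∈ S, g • s ∈ S := fun s hs => by
  have := Set.mem_image_of_mem g.1.1 hs
  rwa [g.1.2.1] at this

omit [AddCommGroup Γ] in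
theorem wordLength_group_smul (g : G) (w : W) : ℓ S (g • w) = ℓ S w :=
  wordLength_of_image S g.1.1 g.1.2.1 w

theorem fixedT_mul {v w : FixedPoints.subgroup G W}
    (hvw : ℓ S ((v : W) * w) = ℓ S (v : W) + ℓ S (w : W)) :
    fixedT S φ G v * fixedT S φ G w = fixedT S φ G (v * w) :=
  Subtype.ext (heckeT_mul hvw)

theorem fixedT_one : fixedT S φ G 1 = 1 := Subtype.ext heckeT_one

theorem repr_mul_of_parabolic (h : IsFoldingLength S (ℓ S)) (hφ : IsWeightFunction S φ) {I : Set W}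
    (hI : I ⊆ S) {u v w : W} (hu : u ∈ Subgroup.closure I) (hv : v ∈ Subgroup.closure I)
    (hw : w ∉ Subgroup.closure I) :
    (heckeBasis h hφ).repr (heckeT S φ u * heckeT S φ v) w = 0 := by
  have hmem : heckeT S φ u * heckeT S φ v ∈
      Submodule.span (WeightRing Γ) (heckeT S φ '' (Subgroup.closure I : Set W)) :=
    heckeT_mul_mem h hI (fun s hs x hx => span_heckeT_mul_mem h (hI hs)
      (fun y hy => mul_mem (Subgroup.subset_closure hs) hy) subset_rfl hx) hu
      (Submodule.subset_span ⟨v, hv, rfl⟩)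
  have h2 : (heckeT S φ : W → _) = heckeBasis h hφ := funext fun w => (heckeBasis_apply h hφ w).symm
  rw [h2, Module.Basis.mem_span_image, ← h2] at hmem
  by_contra hne
  exact hw (hmem (Finsupp.mem_support_iff.2 hne))

variable [Finite G] [Nontrivial G]

theorem brauerMap_fixedT_sq (h : IsFoldingLength S (ℓ S)) (hφ : IsWeightFunction S φ)
    (hp : p.Prime) (hG : IsPGroup p G) {x : FixedPoints.subgroup G W}
    (hx : x ∈ fixedGenerators S G) :
    brauerMap (WeightRing Γ) (HeckeAlgebra S φ) G (fixedT S φ G x * fixedT S φ G x) =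
      brauerMap (WeightRing Γ) (HeckeAlgebra S φ) G
        (1 + heckeParam φ (x : W) • fixedT S φ G x) := by
  classical
  obtain ⟨s, hs, -, hlong⟩ := hx
  have hI : MulAction.orbit G s ⊆ S := IsFoldingLength.orbit_subset group_smul_mem hs
  have hlong : IsLongestElement S (MulAction.orbit G s) (x : W) := hlong
  have hx1 : (x : W) ≠ 1 := fun h1 => by
    have := h.desc_of_longest hI hlong (MulAction.mem_orbit_self s)
    rw [h1, h.one] at this
    omega
  have hxx := h.longest_mul_self hI hlong
  set c := (heckeBasis h hφ).repr (heckeT S φ x * heckeT S φ x) (x : W) with hc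
  have hrepr : ∀ (a : WeightRing Γ) (w : W),
      (heckeBasis h hφ).repr (1 + a • heckeT S φ x) w =
        Finsupp.single 1 1 w + a * Finsupp.single (x : W) 1 w := fun a w => by
    rw [← heckeT_one, map_add, Finsupp.add_apply, map_smul, Finsupp.smul_apply,
      heckeBasis_repr_heckeT, heckeBasis_repr_heckeT, smul_eq_mul]
  have hcases : ∀ w : W, (∀ g : G, g • w = w) →
      (heckeBasis h hφ).repr (heckeT S φ x * heckeT S φ x) w =
        Finsupp.single 1 1 w + c * Finsupp.single (x : W) 1 w := by
    intro w hw
    by_cases hmem : w ∈ Subgroup.closure (MulAction.orbit G s)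
    · rcases h.eq_one_or_longest group_smul_mem wordLength_group_smul hs hw hmem with rfl | hwl
      · rw [repr_mul_one, if_pos hxx, Finsupp.single_eq_same, Finsupp.single_eq_of_ne hx1.symm,
          mul_zero, add_zero]
      · obtain rfl := h.longest_unique hI hwl hlong
        rw [Finsupp.single_eq_same, Finsupp.single_eq_of_ne hx1, mul_one, zero_add]
    · rw [repr_mul_of_parabolic h hφ hI hlong.1 hlong.1 hmem, Finsupp.single_eq_of_ne,
        Finsupp.single_eq_of_ne, mul_zero, add_zero]
      · rintro rfl; exact hmem hlong.1
      · rintro rfl; exact hmem (one_mem _)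
  have hdvd : (p : WeightRing Γ) ∣ c - heckeParam φ (x : W) := by
    have h1 := dvd_weightChar_sub h hφ hp hG (m := fixedT S φ G x * fixedT S φ G x)
      (n := 1 + c • fixedT S φ G x) <| (hecke_brauerMap_eq_iff h hφ hp hG _ _).2 fun w hw => by
        change _ ∣ (heckeBasis h hφ).repr (heckeT S φ x * heckeT S φ x) w -
          (heckeBasis h hφ).repr (1 + c • heckeT S φ x) w
        rw [hcases w hw, hrepr, sub_self]
        exact dvd_zero _
    change _ ∣ weightChar h hφ (heckeT S φ x * heckeT S φ x) -
      weightChar h hφ (1 + c • heckeT S φ x) at h1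
    rw [map_mul, map_add, map_one, map_smul, weightChar_heckeT, smul_eq_mul] at h1
    have h2 := expo_mul_neg (φ (x : W))
    have h3 : c - heckeParam φ (x : W) = -(expo (-φ (x : W)) *
        (expo (φ (x : W)) * expo (φ (x : W)) - (1 + c * expo (φ (x : W))))) := by
      rw [heckeParam]
      linear_combination (expo (φ (x : W)) - c) * h2
    rw [h3]
    exact (h1.mul_left _).neg_right
  refine (hecke_brauerMap_eq_iff h hφ hp hG _ _).2 fun w hw => ?_
  change _ ∣ (heckeBasis h hφ).repr (heckeT S φ x * heckeT S φ x) w -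
    (heckeBasis h hφ).repr (1 + heckeParam φ (x : W) • heckeT S φ x) w
  rw [hcases w hw, hrepr, add_sub_add_left_eq_sub, ← sub_mul]
  exact hdvd.mul_right _

end Quadratic

/-! ## The Hecke algebra of the fixed points -/

theorem brauerMap_surjective (R M G : Type*) [CommRing R] [Ring M] [Algebra R M] [Group G]
    [Finite G] [MulSemiringAction G M] [SMulCommClass G R M] :
    Function.Surjective (brauerMap R M G) :=
  Ideal.Quotient.mk_surjective

section FixedPointAlgebra

variable {W Γ : Type*} [Group W] [AddCommGroup Γ] {S : Set W} {φ : W → Γ}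
  {G : Subgroup (weightAut S φ)} {p : ℕ}

local notation "ℓ" => wordLength

theorem isWeightFunction_fixedWeight
    (h' : IsFoldingLength (fixedGenerators S G) (fun w : FixedPoints.subgroup G W => ℓ S (w : W)))
    (hφ : IsWeightFunction S φ) : IsWeightFunction (fixedGenerators S G) (fixedWeight φ G) :=
  fun v w hvw => hφ v w (h'.additive v w hvw)

variable [Finite G] [Nontrivial G]

/-- The morphism `can_G`, with `T_w ↦ br_G(T_w)`. -/
noncomputable def brauerLift (h : IsFoldingLength S (ℓ S))
    (h' : IsFoldingLength (fixedGenerators S G) (fun w : FixedPoints.subgroup G W => ℓ S (w : W)))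
    (hφ : IsWeightFunction S φ) (hp : p.Prime) (hG : IsPGroup p G) :
    HeckeAlgebra (fixedGenerators S G) (fixedWeight φ G) →ₐ[WeightRing Γ]
      BrauerQuotient (WeightRing Γ) (HeckeAlgebra S φ) G :=
  RingQuot.liftAlgHom (WeightRing Γ) ⟨FreeAlgebra.lift (WeightRing Γ) fun w =>
    brauerMap (WeightRing Γ) (HeckeAlgebra S φ) G (fixedT S φ G w), by
      intro x y hxy
      induction hxy with
      | one =>
        rw [FreeAlgebra.lift_ι_apply, map_one, fixedT_one]
        exact map_one (brauerMap (WeightRing Γ) (HeckeAlgebra S φ) G)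
      | mul v w hvw =>
        rw [map_mul, FreeAlgebra.lift_ι_apply, FreeAlgebra.lift_ι_apply, FreeAlgebra.lift_ι_apply,
          ← fixedT_mul (h'.additive v w hvw)]
        exact (map_mul (brauerMap (WeightRing Γ) (HeckeAlgebra S φ) G) _ _).symm
      | quad x hx =>
        simp only [map_mul, map_sub, map_add, map_zero, FreeAlgebra.lift_ι_apply, AlgHom.commutes]
        refine (sq_eq_of_quad (R := WeightRing Γ)
          (A := BrauerQuotient (WeightRing Γ) (HeckeAlgebra S φ) G) (expo_mul_neg _) _).2 ?_
        have := brauerMap_fixedT_sq h hφ hp hG hx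
        rw [map_mul, map_add, map_one, map_smul] at this
        exact this⟩

theorem brauerLift_heckeT (h : IsFoldingLength S (ℓ S))
    (h' : IsFoldingLength (fixedGenerators S G) (fun w : FixedPoints.subgroup G W => ℓ S (w : W)))
    (hφ : IsWeightFunction S φ) (hp : p.Prime) (hG : IsPGroup p G) (w : FixedPoints.subgroup G W) :
    brauerLift h h' hφ hp hG (heckeT (fixedGenerators S G) (fixedWeight φ G) w) =
      brauerMap (WeightRing Γ) (HeckeAlgebra S φ) G (fixedT S φ G w) := by
  simp only [brauerLift, heckeT, RingQuot.liftAlgHom_mkAlgHom_apply, FreeAlgebra.lift_ι_apply]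

/-- The basis of the Hecke algebra of the fixed points. -/
noncomputable abbrev fixedBasis
    (h' : IsFoldingLength (fixedGenerators S G) (fun w : FixedPoints.subgroup G W => ℓ S (w : W)))
    (hφ : IsWeightFunction S φ) :
    Module.Basis (FixedPoints.subgroup G W) (WeightRing Γ)
      (HeckeAlgebra (fixedGenerators S G) (fixedWeight φ G)) :=
  heckeBasis h'.wordLength (isWeightFunction_fixedWeight h' hφ)

theorem brauerLift_eq_iff (h : IsFoldingLength S (ℓ S))
    (h' : IsFoldingLength (fixedGenerators S G) (fun w : FixedPoints.subgroup G W => ℓ S (w : W)))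
    (hφ : IsWeightFunction S φ) (hp : p.Prime) (hG : IsPGroup p G)
    (n : HeckeAlgebra (fixedGenerators S G) (fixedWeight φ G))
    (m : FixedPoints.subalgebra (WeightRing Γ) (HeckeAlgebra S φ) G) :
    brauerLift h h' hφ hp hG n = brauerMap (WeightRing Γ) (HeckeAlgebra S φ) G m ↔
      ∀ w : FixedPoints.subgroup G W, (p : WeightRing Γ) ∣
        (fixedBasis h' hφ).repr n w - (heckeBasis h hφ).repr (m : HeckeAlgebra S φ) w := by
  have := eq_brauerMap_iff (R := WeightRing Γ) (M := HeckeAlgebra S φ) (G := G)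
    (N := HeckeAlgebra (fixedGenerators S G) (fixedWeight φ G)) (κ := FixedPoints.subgroup G W)
    (f := Subtype.val) hp hG (heckeBasis h hφ) (by
      intro g w
      exact smul_heckeBasis h hφ g w) (fixedBasis h' hφ) Subtype.val_injective
    (fun w => ⟨fun hw => ⟨⟨w, hw⟩, rfl⟩, fun ⟨v, hv⟩ => hv ▸ v.2⟩)
    (brauerLift h h' hφ hp hG).toLinearMap (fixedT S φ G) (by
      intro w
      exact (heckeBasis_apply h hφ w).symm) (by
      intro w
      refine (congrArg (brauerLift h h' hφ hp hG) (heckeBasis_apply _ _ w)).trans ?_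
      exact brauerLift_heckeT h h' hφ hp hG w)
  exact this n m

/-- The coordinates of an element of the Hecke algebra at the fixed points. -/
noncomputable def heckeFixedPart (h : IsFoldingLength S (ℓ S))
    (h' : IsFoldingLength (fixedGenerators S G) (fun w : FixedPoints.subgroup G W => ℓ S (w : W)))
    (hφ : IsWeightFunction S φ) (m : HeckeAlgebra S φ) :
    HeckeAlgebra (fixedGenerators S G) (fixedWeight φ G) :=
  fixedPart (heckeBasis h hφ) (fixedBasis h' hφ) Subtype.val_injective m

omit [Finite G] [Nontrivial G] in
theorem repr_heckeFixedPart (h : IsFoldingLength S (ℓ S))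
    (h' : IsFoldingLength (fixedGenerators S G) (fun w : FixedPoints.subgroup G W => ℓ S (w : W)))
    (hφ : IsWeightFunction S φ) (m : HeckeAlgebra S φ) (w : FixedPoints.subgroup G W) :
    (fixedBasis h' hφ).repr (heckeFixedPart h h' hφ m) w = (heckeBasis h hφ).repr m w :=
  repr_fixedPart _ _ _ _ _

theorem brauerLift_heckeFixedPart (h : IsFoldingLength S (ℓ S))
    (h' : IsFoldingLength (fixedGenerators S G) (fun w : FixedPoints.subgroup G W => ℓ S (w : W)))
    (hφ : IsWeightFunction S φ) (hp : p.Prime) (hG : IsPGroup p G)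
    (m : FixedPoints.subalgebra (WeightRing Γ) (HeckeAlgebra S φ) G) :
    brauerLift h h' hφ hp hG (heckeFixedPart h h' hφ (m : HeckeAlgebra S φ)) =
      brauerMap (WeightRing Γ) (HeckeAlgebra S φ) G m :=
  (brauerLift_eq_iff h h' hφ hp hG _ _).2 fun w => by
    rw [repr_heckeFixedPart, sub_self]
    exact dvd_zero _

theorem brauerLift_surjective (h : IsFoldingLength S (ℓ S))
    (h' : IsFoldingLength (fixedGenerators S G) (fun w : FixedPoints.subgroup G W => ℓ S (w : W)))
    (hφ : IsWeightFunction S φ) (hp : p.Prime) (hG : IsPGroup p G) :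
    Function.Surjective (brauerLift h h' hφ hp hG) := fun y => by
  obtain ⟨m, rfl⟩ := brauerMap_surjective (WeightRing Γ) (HeckeAlgebra S φ) G y
  exact ⟨_, brauerLift_heckeFixedPart h h' hφ hp hG m⟩

theorem brauerLift_eq_zero_iff (h : IsFoldingLength S (ℓ S))
    (h' : IsFoldingLength (fixedGenerators S G) (fun w : FixedPoints.subgroup G W => ℓ S (w : W)))
    (hφ : IsWeightFunction S φ) (hp : p.Prime) (hG : IsPGroup p G)
    (n : HeckeAlgebra (fixedGenerators S G) (fixedWeight φ G)) :
    brauerLift h h' hφ hp hG n = 0 ↔ ∃ n', n = p • n' := by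
  rw [hecke_exists_nsmul_iff h'.wordLength (isWeightFunction_fixedWeight h' hφ)]
  have h1 := brauerLift_eq_iff h h' hφ hp hG n 0
  have h2 : ∀ w, (heckeBasis h hφ).repr
      ((0 : FixedPoints.subalgebra (WeightRing Γ) (HeckeAlgebra S φ) G) : HeckeAlgebra S φ) w = 0 :=
    fun w => by
      rw [ZeroMemClass.coe_zero, map_zero]
      rfl
  rw [map_zero] at h1
  simpa only [h2, sub_zero] using h1

theorem brauerLift_unique (h : IsFoldingLength S (ℓ S))
    (h' : IsFoldingLength (fixedGenerators S G) (fun w : FixedPoints.subgroup G W => ℓ S (w : W)))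
    (hφ : IsWeightFunction S φ) (hp : p.Prime) (hG : IsPGroup p G)
    (f : HeckeAlgebra (fixedGenerators S G) (fixedWeight φ G) →ₗ[WeightRing Γ]
      BrauerQuotient (WeightRing Γ) (HeckeAlgebra S φ) G)
    (hf : ∀ w : FixedPoints.subgroup G W,
      f (heckeT (fixedGenerators S G) (fixedWeight φ G) w) =
        brauerMap (WeightRing Γ) (HeckeAlgebra S φ) G (fixedT S φ G w)) :
    f = (brauerLift h h' hφ hp hG).toLinearMap :=
  (fixedBasis h' hφ).ext fun w => by
    refine (congrArg f (heckeBasis_apply _ _ w)).trans ((hf w).trans ?_)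
    refine (brauerLift_heckeT h h' hφ hp hG w).symm.trans ?_
    exact (congrArg (brauerLift h h' hφ hp hG) (heckeBasis_apply _ _ w)).symm

theorem exists_zmod_tensor_brauer_equiv (h : IsFoldingLength S (ℓ S))
    (h' : IsFoldingLength (fixedGenerators S G) (fun w : FixedPoints.subgroup G W => ℓ S (w : W)))
    (hφ : IsWeightFunction S φ) (hp : p.Prime) (hG : IsPGroup p G) :
    ∃ e : (ZMod p ⊗[ℤ] HeckeAlgebra (fixedGenerators S G) (fixedWeight φ G)) ≃+*
        BrauerQuotient (WeightRing Γ) (HeckeAlgebra S φ) G,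
      ∀ n, e (1 ⊗ₜ[ℤ] n) = brauerLift h h' hφ hp hG n := by
  have := exists_zmod_tensor_equiv (A := HeckeAlgebra (fixedGenerators S G) (fixedWeight φ G))
    (B := BrauerQuotient (WeightRing Γ) (HeckeAlgebra S φ) G) p
    (brauerLift h h' hφ hp hG : _ →+* _) (brauerLift_surjective h h' hφ hp hG) (by
      intro n
      exact brauerLift_eq_zero_iff h h' hφ hp hG n)
  exact this

end FixedPointAlgebra

/-! ## Kazhdan-Lusztig elements and the Brauer quotient -/

section FixedKazhdanLusztig

variable {W Γ : Type*} [Group W] [AddCommGroup Γ] {S : Set W} {φ : W → Γ}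
  {G : Subgroup (weightAut S φ)} {p : ℕ}

local notation "ℓ" => wordLength

theorem exists_brauerMap_bar [Finite G] {b : HeckeAlgebra S φ →+* HeckeAlgebra S φ}
    (hb : IsBarInvolution S φ b) :
    ∃ β : BrauerQuotient (WeightRing Γ) (HeckeAlgebra S φ) G →+*
        BrauerQuotient (WeightRing Γ) (HeckeAlgebra S φ) G,
      ∀ m n : FixedPoints.subalgebra (WeightRing Γ) (HeckeAlgebra S φ) G,
        (n : HeckeAlgebra S φ) = b m →
          β (brauerMap (WeightRing Γ) (HeckeAlgebra S φ) G m) =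
            brauerMap (WeightRing Γ) (HeckeAlgebra S φ) G n := by
  have := exists_brauerMap_endo (R := WeightRing Γ) (M := HeckeAlgebra S φ) (G := G) b (weightBar Γ)
    (by
      intro a x
      exact hb.map_smul_bar a x) (by
      intro g x
      exact hb.map_act g.1 x)
  exact this

theorem brauerLift_bar [Finite G] [Nontrivial G] (h : IsFoldingLength S (ℓ S))
    (h' : IsFoldingLength (fixedGenerators S G) (fun w : FixedPoints.subgroup G W => ℓ S (w : W)))
    (hφ : IsWeightFunction S φ) (hp : p.Prime) (hG : IsPGroup p G)
    {b : HeckeAlgebra S φ →+* HeckeAlgebra S φ} (hb : IsBarInvolution S φ b)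
    {b' : HeckeAlgebra (fixedGenerators S G) (fixedWeight φ G) →+*
      HeckeAlgebra (fixedGenerators S G) (fixedWeight φ G)}
    (hb' : IsBarInvolution (fixedGenerators S G) (fixedWeight φ G) b')
    {β : BrauerQuotient (WeightRing Γ) (HeckeAlgebra S φ) G →+*
        BrauerQuotient (WeightRing Γ) (HeckeAlgebra S φ) G}
    (hβ : ∀ m n : FixedPoints.subalgebra (WeightRing Γ) (HeckeAlgebra S φ) G,
        (n : HeckeAlgebra S φ) = b m →
          β (brauerMap (WeightRing Γ) (HeckeAlgebra S φ) G m) =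
            brauerMap (WeightRing Γ) (HeckeAlgebra S φ) G n)
    (x : HeckeAlgebra (fixedGenerators S G) (fixedWeight φ G)) :
    brauerLift h h' hφ hp hG (b' x) = β (brauerLift h h' hφ hp hG x) := by
  have hcomp : (brauerLift h h' hφ hp hG : _ →+* _).comp b' =
      β.comp (brauerLift h h' hφ hp hG : _ →+* _) := by
    refine hecke_ringHom_ext (S := fixedGenerators S G) (φ := fixedWeight φ G) (fun γ => ?_)
      fun w => ?_
    · change brauerLift h h' hφ hp hG (b' (algebraMap (WeightRing Γ) _ (expo γ))) =
        β (brauerLift h h' hφ hp hG (algebraMap (WeightRing Γ) _ (expo γ)))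
      rw [hb'.expo, AlgHom.commutes, AlgHom.commutes]
      exact (hβ (algebraMap _ _ (expo γ)) (algebraMap _ _ (expo (-γ))) (hb.expo γ).symm).symm
    · change brauerLift h h' hφ hp hG (b' (heckeT _ _ w)) =
        β (brauerLift h h' hφ hp hG (heckeT _ _ w))
      let n : FixedPoints.subalgebra (WeightRing Γ) (HeckeAlgebra S φ) G :=
        ⟨b (heckeT S φ w), fun g =>
          (hb.map_act g.1 _).symm.trans (congrArg b ((fixedT S φ G w).2 g))⟩
      have e1 : brauerLift h h' hφ hp hG (b' (heckeT _ _ w)) *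
          brauerLift h h' hφ hp hG (heckeT _ _ w⁻¹) = 1 := by
        rw [← map_mul, hb'.mul_inv, map_one]
      have e2 : fixedT S φ G w⁻¹ * n = 1 := Subtype.ext (hb.inv_mul (w : W))
      refine left_inv_eq_right_inv e1 ?_
      rw [brauerLift_heckeT, brauerLift_heckeT, hβ _ n rfl]
      exact (map_mul (brauerMap (WeightRing Γ) (HeckeAlgebra S φ) G) _ _).symm.trans
        ((congrArg _ e2).trans (map_one _))
  exact RingHom.congr_fun hcomp x

variable [LinearOrder Γ]

theorem smul_mem_heckeNeg (σ : weightAut S φ) {x : HeckeAlgebra S φ} (hx : x ∈ heckeNeg S φ) :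
    σ • x ∈ heckeNeg S φ := by
  have : heckeNeg S φ ≤ (heckeNeg S φ).comap (heckeAct S φ σ : HeckeAlgebra S φ →+ _) := by
    rw [heckeNeg, AddSubgroup.closure_le]
    rintro _ ⟨γ, w, hγ, rfl⟩
    refine AddSubgroup.subset_closure ⟨γ, σ.1 w, hγ, ?_⟩
    exact (map_smul (heckeAct S φ σ) _ _).trans
      (congrArg (expo γ • ·) (heckeAct_heckeT S φ σ w))
  exact this hx

theorem IsKLElement.smul {w : W} {C : HeckeAlgebra S φ} (hC : IsKLElement S φ w C)
    (σ : weightAut S φ) : IsKLElement S φ (σ • w) (σ • C) := by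
  obtain ⟨⟨b, hb, hbC⟩, hn⟩ := hC
  refine ⟨⟨b, hb, by rw [hb.map_act, hbC]⟩, ?_⟩
  have := smul_mem_heckeNeg σ hn
  have e : σ • (C - heckeT S φ w) = σ • C - heckeT S φ (σ • w) := by
    rw [← smul_heckeT]
    exact map_sub (heckeAct S φ σ) C (heckeT S φ w)
  rwa [e] at this

variable [IsOrderedAddMonoid Γ]

theorem IsKLElement.mem_fixedPoints (h : IsFoldingLength S (ℓ S)) (hφ : IsWeightFunction S φ)
    {w : FixedPoints.subgroup G W} {C : HeckeAlgebra S φ} (hC : IsKLElement S φ (w : W) C) :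
    C ∈ FixedPoints.subalgebra (WeightRing Γ) (HeckeAlgebra S φ) G := fun g => by
  have h1 := hC.smul g.1
  have h2 : g.1 • (w : W) = w := w.2 g
  rw [h2] at h1
  exact (existsUnique_isKLElement h hφ (w : W)).unique h1 hC

theorem brauerLift_isKLElement [Finite G] [Nontrivial G] (h : IsFoldingLength S (ℓ S))
    (h' : IsFoldingLength (fixedGenerators S G) (fun w : FixedPoints.subgroup G W => ℓ S (w : W)))
    (hφ : IsWeightFunction S φ) (hp : p.Prime) (hG : IsPGroup p G) {w : FixedPoints.subgroup G W}
    {C' : HeckeAlgebra (fixedGenerators S G) (fixedWeight φ G)}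
    {m : FixedPoints.subalgebra (WeightRing Γ) (HeckeAlgebra S φ) G}
    (hC' : IsKLElement (fixedGenerators S G) (fixedWeight φ G) w C')
    (hm : IsKLElement S φ (w : W) (m : HeckeAlgebra S φ)) :
    brauerLift h h' hφ hp hG C' = brauerMap (WeightRing Γ) (HeckeAlgebra S φ) G m := by
  obtain ⟨⟨b, hb, hbC⟩, hn⟩ := hm
  obtain ⟨⟨b', hb', hbC'⟩, hn'⟩ := hC'
  obtain ⟨β, hβ⟩ := exists_brauerMap_bar (G := G) hb
  have hbar := brauerLift_bar h h' hφ hp hG hb hb' hβ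
  have hd := brauerLift_heckeFixedPart h h' hφ hp hG m
  set d := heckeFixedPart h h' hφ (m : HeckeAlgebra S φ) with hd_def
  have hφ' := isWeightFunction_fixedWeight h' hφ
  have hy : d - C' ∈ heckeNeg (fixedGenerators S G) (fixedWeight φ G) := by
    rw [mem_heckeNeg_iff h hφ] at hn
    rw [mem_heckeNeg_iff h'.wordLength hφ'] at hn' ⊢
    intro v γ hγ
    have e1 := hn v γ hγ
    have e2 := hn' v γ hγ
    have e3 := repr_heckeFixedPart h h' hφ (m : HeckeAlgebra S φ) v
    rw [repr_sub_apply, heckeBasis_repr_heckeT, AddMonoidAlgebra.coeff_sub, Finsupp.sub_apply] at e1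
    rw [repr_sub_apply, heckeBasis_repr_heckeT, AddMonoidAlgebra.coeff_sub, Finsupp.sub_apply,
      ← Finsupp.single_apply_left Subtype.val_injective] at e2
    rw [repr_sub_apply, e3, AddMonoidAlgebra.coeff_sub, Finsupp.sub_apply, sub_eq_zero.1 e1,
      sub_eq_zero.1 e2, sub_self]
  have hker : brauerLift h h' hφ hp hG (b' (d - C') - (d - C')) = 0 := by
    have e : brauerLift h h' hφ hp hG (b' (d - C')) = brauerLift h h' hφ hp hG (d - C') := by
      rw [map_sub b' d C', hbC', map_sub _ (b' d) C', map_sub _ d C', hbar, hd, hβ m m hbC.symm]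
    rw [map_sub _ (b' (d - C')) (d - C'), e]
    exact sub_self _
  have hy0 := hb'.exists_nsmul_of_neg h'.wordLength hφ' p hy
    ((brauerLift_eq_zero_iff h h' hφ hp hG _).1 hker)
  have hz := (brauerLift_eq_zero_iff h h' hφ hp hG _).2 hy0
  rw [map_sub _ d C', hd] at hz
  exact (sub_eq_zero.1 hz).symm

end FixedKazhdanLusztig

theorem propositionB {B W Γ : Type*} [Finite B] [Group W] {M : CoxeterMatrix B}
    (cs : CoxeterSystem M W) (S : Set W) (hS : S = Set.range cs.simple)
    [AddCommGroup Γ] [LinearOrder Γ] [IsOrderedAddMonoid Γ]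
    (φ : W → Γ) (hφ : IsWeightFunction S φ)
    (p : ℕ) (hp : p.Prime)
    (G : Subgroup (weightAut S φ)) [Finite G] [Nontrivial G] (hG : IsPGroup p G) :
    -- the Kazhdan-Lusztig elements of both Hecke algebras are well defined
    (∀ w : W, ∃! C, IsKLElement S φ w C) ∧
    (∀ w : FixedPoints.subgroup G W,
      ∃! C, IsKLElement (fixedGenerators S G) (fixedWeight φ G) w C) ∧
    -- the morphism of algebras `can_G`
    ∃ can : HeckeAlgebra (fixedGenerators S G) (fixedWeight φ G) →ₐ[WeightRing Γ]
        BrauerQuotient (WeightRing Γ) (HeckeAlgebra S φ) G,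
      (∀ w : FixedPoints.subgroup G W,
        can (heckeT (fixedGenerators S G) (fixedWeight φ G) w) =
          brauerMap (WeightRing Γ) (HeckeAlgebra S φ) G (fixedT S φ G w)) ∧
      -- it is the only linear map with these values on the standard basis
      (∀ f : HeckeAlgebra (fixedGenerators S G) (fixedWeight φ G) →ₗ[WeightRing Γ]
          BrauerQuotient (WeightRing Γ) (HeckeAlgebra S φ) G,
        (∀ w : FixedPoints.subgroup G W,
          f (heckeT (fixedGenerators S G) (fixedWeight φ G) w) =
            brauerMap (WeightRing Γ) (HeckeAlgebra S φ) G (fixedT S φ G w)) →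
        f = can.toLinearMap) ∧
      Function.Surjective can ∧
      -- its kernel is `p H_G`
      (∀ h, can h = 0 ↔ ∃ h', h = p • h') ∧
      -- it induces an isomorphism from `𝔽_p ⊗ H_G` onto the Brauer quotient
      (∃ e : (ZMod p ⊗[ℤ] HeckeAlgebra (fixedGenerators S G) (fixedWeight φ G)) ≃+*
          BrauerQuotient (WeightRing Γ) (HeckeAlgebra S φ) G,
        ∀ h, e (1 ⊗ₜ[ℤ] h) = can h) ∧
      -- it maps `C_w^G` to `br_G(C_w)`
      (∀ (w : FixedPoints.subgroup G W)
        (C' : HeckeAlgebra (fixedGenerators S G) (fixedWeight φ G)) (C : HeckeAlgebra S φ),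
        IsKLElement (fixedGenerators S G) (fixedWeight φ G) w C' →
        IsKLElement S φ (w : W) C →
        ∃ hC : C ∈ FixedPoints.subalgebra (WeightRing Γ) (HeckeAlgebra S φ) G,
          can C' = brauerMap (WeightRing Γ) (HeckeAlgebra S φ) G ⟨C, hC⟩) := by
  subst hS
  have h := cs.isFoldingLength.wordLength
  have h' := h.fixedPoints (G := G) (Set.finite_range _) group_smul_mem wordLength_group_smul
  exact ⟨existsUnique_isKLElement h hφ,
    existsUnique_isKLElement h'.wordLength (isWeightFunction_fixedWeight h' hφ),
    brauerLift h h' hφ hp hG, brauerLift_heckeT h h' hφ hp hG, brauerLift_unique h h' hφ hp hG,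
    brauerLift_surjective h h' hφ hp hG, brauerLift_eq_zero_iff h h' hφ hp hG,
    exists_zmod_tensor_brauer_equiv h h' hφ hp hG, fun w C' C hC' hC =>
      ⟨hC.mem_fixedPoints h hφ, brauerLift_isKLElement h h' hφ hp hG hC' hC⟩⟩
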